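/- Let $K$ be an algebraically closed field of characteristic $0$. Define polynomial maps $A_n,B_n,G_n:\mathbb A^2\to\mathbb A^2$ over $K$ ($n\ge 0$), with components denoted $(X_n,Y_n)$ in each case, by the following recursions. * $A_0=(3,0)$, $A_1=(x,y)$, $A_2=(x^2-y^2-2x,\;2xy+2y)$, and $X_{n+3}=x(X_{n+2}-X_{n+1})-y(Y_{n+2}+Y_{n+1})+X_n$, $\;Y_{n+3}=x(Y_{n+2}-Y_{n+1})+y(X_{n+2}+X_{n+1})+Y_n$. (Writing $z=x+iy$, $\bar z=x-iy$, this is $A_{n+3}=zA_{n+2}-\bar zA_{n+1}+A_n$ with $A_0=3$, $A_1=z$, $A_2=z^2-2\bar z$.) * $B_0=(4,4)$, $B_1=(x,y)$, $B_2=(x^2-2y-4,\;y^2-2x^2+4y+4)$, $B_3=(x^3-3xy-3x,\;y^3-3x^2y+6y^2+9y)$, and $X_{n+4}=x(X_{n+3}+X_{n+1})-(2+y)X_{n+2}-X_n$, $\;Y_{n+4}=y(Y_{n+3}+Y_{n+1})-(x^2-2y-2)Y_{n+2}-Y_n$. * $G_0=(6,6)$, $G_1=(x,y)$, $G_2=(x^2-2x-2y-6,\;-2x^3+6xy+y^2+18x+10y+18)$,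 $G_3=(x^3-3xy-9x-6y-12,\;-3x^3y-6x^3+9xy^2+y^3+45xy+18y^2+54x+63y+60)$; $G_4$ has components $x^4-4x^2y-10x^2-4xy+2y^2-8x+8y+6$ and $2x^6-12x^4y-4x^3y^2-36x^4-28x^3y+18x^2y^2+12xy^3+y^4-40x^3+108x^2y+120xy^2+24y^3+162x^2+372xy+134y^2+360x+280y+198$; $G_5$ has components $x^5-5x^3y-15x^3-5x^2y+5xy^2-10x^2+35xy+10y^2+55x+50y+60$ and $5x^6y+10x^6-30x^4y^2-5x^3y^3-150x^4y-65x^3y^2+45x^2y^3+15xy^4+y^5-180x^4-205x^3y+360x^2y^2+240xy^3+30y^4-190x^3+945x^2y+1200xy^2+255y^3+810x^2+2415xy+920y^2+1710x+1495y+900$; and $X_{n+6}=x(X_{n+5}+X_{n+1})-(x+y+3)(X_{n+4}+X_{n+2})+(x^2-2y-4)X_{n+3}-X_n$, $Y_{n+6}=y(Y_{n+5}+Y_{n+1})-(x^3-3xy-9x-5y-9)(Y_{n+4}+Y_{n+2})+(y^2-2x^3+6xy+18x+12y+20)Y_{n+3}-Y_n$. For a polynomial map $F=(P,Q)$ of $\mathbb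 A^2$ with $d=\max(\deg P,\deg Q)$, its homogenization is the rational map $\overline F=[Z^dP(X/Z,Y/Z),\,Z^dQ(X/Z,Y/Z),\,Z^d]:\mathbb P^2\dashrightarrow\mathbb P^2$. The degree of a rational self-map $f$ of $\mathbb P^2$ is the common degree of its coordinate forms after cancelling common factors; its indeterminacy locus $I(f)$ is the set of points at which no presentation of $f$ by forms is defined, and $f$ is a morphism if $I(f)=\emptyset$; its dynamical degree is $\lim_{m\to\infty}(\deg f^m)^{1/m}$. **Theorem 5.1.** (0) $A_n,B_n,G_n$ are the $n$th folding maps of the Lie algebras $\mathcal A_2,\mathcal B_2,\mathcal G_2$. That is, for a rank two root system let $\varphi_1,\varphi_2$ be the sums of the characters of the torus $(K^\times)^2$ over the Weyl group orbits of the two fundamental weights (for $\mathcal B_2$ and $\mathcal G_2$, the first one is the one belonging to the short simple root), and put $\Phi=(\varphi_1,\varphi_2)$ for $\mathcal B_2$ and $\mathcal G_2$, and $\Phi=\bigl(\tfrac{\varphi_1+\varphi_2}{2},\tfrac{\varphi_1-\varphi_2}{2i}\bigr)$ with $i^2=-1$ (either choice) for $\mathcal A_2$. Then $A_n$ (resp.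 $B_n$, $G_n$) is, for every $n\ge0$, the unique polynomial map $F$ of $\mathbb A^2$ with $F(\Phi(t))=\Phi(t^n)$ for all $t\in(K^\times)^2$. (a) For all $n\ge 0$, $\overline A_n:\mathbb P^2\to\mathbb P^2$ is a morphism of degree $n$. (b) For all $n\ge 0$, $\overline B_n:\mathbb P^2\to\mathbb P^2$ is a morphism of degree $n$. (c) For all $n\ge 0$, $\overline G_n:\mathbb P^2\dashrightarrow\mathbb P^2$ is a rational map of degree $\lfloor 3n/2\rfloor$. If $n\ge2$, then $\overline G_n$ is not a morphism, and its indeterminacy locus is $I(\overline G_n)=\{[0,1,0]\}$ if $n$ is even and $I(\overline G_n)=\{[0,1,0],[1,0,0]\}$ if $n$ is odd. For all $n\ge0$, all iterates of $\overline G_n$ are defined and the dynamical degree of $\overline G_n$ is $n$. -/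

import Mathlib

open MvPolynomial Filter Topology
open scoped LinearAlgebra.Projectivization

noncomputable section

namespace Folding

/-! ### The folding maps of the simple Lie algebras of rank two, by recursion -/

/-- A polynomial self-map of the affine plane, in the coordinates `x = X 0`, `y = X 1`. -/
abbrev AffMap (R : Type*) [CommRing R] := Fin 2 → MvPolynomial (Fin 2) R

/-- The values `A_n(x, y)` in real coordinates: this is the recursion
`A_{n+3} = z A_{n+2} - z̄ A_{n+1} + A_n`, `A_0 = 3`, `A_1 = z`, `A_2 = z² - 2 z̄`,
split into the two components with respect to `z = x + i y`, `z̄ = x - i y`. -/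
def seqA {S : Type*} [CommRing S] (x y : S) : ℕ → Fin 2 → S
  | 0 => ![3, 0]
  | 1 => ![x, y]
  | 2 => ![x ^ 2 - y ^ 2 - 2 * x, 2 * x * y + 2 * y]
  | n + 3 =>
    ![x * (seqA x y (n + 2) 0 - seqA x y (n + 1) 0)
        - y * (seqA x y (n + 2) 1 + seqA x y (n + 1) 1) + seqA x y n 0,
      x * (seqA x y (n + 2) 1 - seqA x y (n + 1) 1)
        + y * (seqA x y (n + 2) 0 + seqA x y (n + 1) 0) + seqA x y n 1]

/-- The values `B_n(x, y)`. -/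
def seqB {S : Type*} [CommRing S] (x y : S) : ℕ → Fin 2 → S
  | 0 => ![4, 4]
  | 1 => ![x, y]
  | 2 => ![x ^ 2 - 2 * y - 4, y ^ 2 - 2 * x ^ 2 + 4 * y + 4]
  | 3 => ![x ^ 3 - 3 * x * y - 3 * x,
           y ^ 3 - 3 * x ^ 2 * y + 6 * y ^ 2 + 9 * y]
  | n + 4 =>
    ![x * (seqB x y (n + 3) 0 + seqB x y (n + 1) 0) - (2 + y) * seqB x y (n + 2) 0
        - seqB x y n 0,
      y * (seqB x y (n + 3) 1 + seqB x y (n + 1) 1)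
        - (x ^ 2 - 2 * y - 2) * seqB x y (n + 2) 1 - seqB x y n 1]

/-- The values `G_n(x, y)`. -/
def seqG {S : Type*} [CommRing S] (x y : S) : ℕ → Fin 2 → S
  | 0 => ![6, 6]
  | 1 => ![x, y]
  | 2 => ![x ^ 2 - 2 * x - 2 * y - 6,
           -2 * x ^ 3 + 6 * x * y + y ^ 2 + 18 * x + 10 * y + 18]
  | 3 => ![x ^ 3 - 3 * x * y - 9 * x - 6 * y - 12,
           -3 * x ^ 3 * y - 6 * x ^ 3 + 9 * x * y ^ 2 + y ^ 3 + 45 * x * y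
             + 18 * y ^ 2 + 54 * x + 63 * y + 60]
  | 4 => ![x ^ 4 - 4 * x ^ 2 * y - 10 * x ^ 2 - 4 * x * y + 2 * y ^ 2
             - 8 * x + 8 * y + 6,
           2 * x ^ 6 - 12 * x ^ 4 * y - 4 * x ^ 3 * y ^ 2 - 36 * x ^ 4
             - 28 * x ^ 3 * y + 18 * x ^ 2 * y ^ 2 + 12 * x * y ^ 3 + y ^ 4
             - 40 * x ^ 3 + 108 * x ^ 2 * y + 120 * x * y ^ 2 + 24 * y ^ 3
             + 162 * x ^ 2 + 372 * x * y + 134 * y ^ 2 + 360 * x + 280 * y + 198]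
  | 5 => ![x ^ 5 - 5 * x ^ 3 * y - 15 * x ^ 3 - 5 * x ^ 2 * y
             + 5 * x * y ^ 2 - 10 * x ^ 2 + 35 * x * y + 10 * y ^ 2
             + 55 * x + 50 * y + 60,
           5 * x ^ 6 * y + 10 * x ^ 6 - 30 * x ^ 4 * y ^ 2
             - 5 * x ^ 3 * y ^ 3 - 150 * x ^ 4 * y - 65 * x ^ 3 * y ^ 2
             + 45 * x ^ 2 * y ^ 3 + 15 * x * y ^ 4 + y ^ 5 - 180 * x ^ 4
             - 205 * x ^ 3 * y + 360 * x ^ 2 * y ^ 2 + 240 * x * y ^ 3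
             + 30 * y ^ 4 - 190 * x ^ 3 + 945 * x ^ 2 * y + 1200 * x * y ^ 2
             + 255 * y ^ 3 + 810 * x ^ 2 + 2415 * x * y + 920 * y ^ 2
             + 1710 * x + 1495 * y + 900]
  | n + 6 =>
    ![x * (seqG x y (n + 5) 0 + seqG x y (n + 1) 0)
        - (x + y + 3) * (seqG x y (n + 4) 0 + seqG x y (n + 2) 0)
        + (x ^ 2 - 2 * y - 4) * seqG x y (n + 3) 0 - seqG x y n 0,
      y * (seqG x y (n + 5) 1 + seqG x y (n + 1) 1)
        - (x ^ 3 - 3 * x * y - 9 * x - 5 * y - 9)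
            * (seqG x y (n + 4) 1 + seqG x y (n + 2) 1)
        + (y ^ 2 - 2 * x ^ 3 + 6 * x * y + 18 * x + 12 * y + 20)
            * seqG x y (n + 3) 1 - seqG x y n 1]

/-- The folding map `A_n` as a pair of polynomials. -/
def foldA (R : Type*) [CommRing R] (n : ℕ) : AffMap R := seqA (X 0) (X 1) n

/-- The folding map `B_n` as a pair of polynomials. -/
def foldB (R : Type*) [CommRing R] (n : ℕ) : AffMap R := seqB (X 0) (X 1) n

/-- The folding map `G_n` as a pair of polynomials. -/
def foldG (R : Type*) [CommRing R] (n : ℕ) : AffMap R := seqG (X 0) (X 1) n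

/-! ### The characterization of folding maps through Weyl group orbits

Weights are written in the basis of the fundamental weights. The row `C i` of a Cartan matrix
`C` (with entries `C i j = ⟨α_i, α_j^∨⟩`) is then the simple root `α_i`. A point `t` of the torus
`(Kˣ)²` is an element of the Cartan subalgebra modulo the lattice dual to the weights, and
`x ↦ n x` becomes `t ↦ t ^ n`. -/

def cartanA : Matrix (Fin 2) (Fin 2) ℤ := !![2, -1; -1, 2]

/-- The first simple root is the short one. -/
def cartanB : Matrix (Fin 2) (Fin 2) ℤ := !![2, -1; -2, 2]

/-- The first simple root is the short one. -/
def cartanG : Matrix (Fin 2) (Fin 2) ℤ := !![2, -1; -3, 2]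

/-- The simple reflection `s_i(v) = v - ⟨v, α_i^∨⟩ α_i`. -/
def simpleReflection (C : Matrix (Fin 2) (Fin 2) ℤ) (i : Fin 2) (v : Fin 2 → ℤ) : Fin 2 → ℤ :=
  v - v i • C i

/-- The orbit of the weight `v` under the Weyl group, which is generated by the simple
reflections (and these are involutions). -/
def weylOrbit (C : Matrix (Fin 2) (Fin 2) ℤ) (v : Fin 2 → ℤ) : Set (Fin 2 → ℤ) :=
  {w | Relation.ReflTransGen (fun a b => ∃ i, b = simpleReflection C i a) v w}

/-- The sum of the characters `t ↦ t ^ w` over the Weyl orbit of the `k`-th fundamental weight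
(a finite sum for the three Cartan matrices above). -/
def orbitSum {K : Type*} [Field K] (C : Matrix (Fin 2) (Fin 2) ℤ) (t : Fin 2 → Kˣ) (k : Fin 2) :
    K :=
  ∑ᶠ w ∈ weylOrbit C (Pi.single k 1), ((∏ j, t j ^ w j : Kˣ) : K)

/-- For `A_2` the two orbit sums are `z = x + i y` and `z̄ = x - i y`; this is `(x, y)`. -/
def realCoordA {K : Type*} [Field K] (i : K) (t : Fin 2 → Kˣ) : Fin 2 → K :=
  ![(orbitSum cartanA t 0 + orbitSum cartanA t 1) / 2,
    (orbitSum cartanA t 0 - orbitSum cartanA t 1) / (2 * i)]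

/-- `F` is an `n`-th folding map for the invariant coordinates `Φ`: `F(Φ(t)) = Φ(t ^ n)`. -/
def IsFoldingMap {K : Type*} [Field K] (Φ : (Fin 2 → Kˣ) → Fin 2 → K) (n : ℕ) (F : AffMap K) :
    Prop :=
  ∀ (t : Fin 2 → Kˣ) (k : Fin 2), eval (Φ t) (F k) = Φ (t ^ n) k

/-! ### Rational self-maps of the projective plane -/

/-- A presentation `[F_0, F_1, F_2]` of a rational map from `ℙ²` to `ℙ²`: three forms of the same
degree, not all zero. Common factors are allowed. -/
structure RatMap (K : Type*) [Field K] where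
  deg : ℕ
  coord : Fin 3 → MvPolynomial (Fin 3) K
  homog : ∀ i, (coord i).IsHomogeneous deg
  exists_ne_zero : ∃ i, coord i ≠ 0

variable {K : Type*} [Field K]

/-- Two presentations define the same rational map. -/
def RatMap.Same (F G : RatMap K) : Prop :=
  ∀ i j, F.coord i * G.coord j = F.coord j * G.coord i

/-- The degree of a rational map: the least degree of a presentation, that is, the degree of a
presentation without common factor. -/
def RatMap.degree (F : RatMap K) : ℕ :=
  sInf {d | ∃ G : RatMap K, F.Same G ∧ G.deg = d}

/-- The points at which no presentation of the rational map is defined. -/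
def RatMap.indeterminacy (F : RatMap K) : Set (ℙ K (Fin 3 → K)) :=
  {p | ∀ G : RatMap K, F.Same G → ∀ i, eval p.rep (G.coord i) = 0}

def RatMap.IsMorphism (F : RatMap K) : Prop := F.indeterminacy = ∅

/-- `H` is the composition `F ∘ G` (which exists for a suitable presentation of `F` exactly if the
image of `G` is not contained in the indeterminacy locus of `F`). -/
def RatMap.IsComp (F G H : RatMap K) : Prop :=
  ∃ F' : RatMap K, F.Same F' ∧ (∃ i, bind₁ G.coord (F'.coord i) ≠ 0) ∧
    ∀ i j, H.coord i * bind₁ G.coord (F'.coord j) = H.coord j * bind₁ G.coord (F'.coord i)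

/-- All iterates `F^m` exist (`it m` is `F^(m+1)`), and `(deg F^m)^(1/m)` tends to `δ`. -/
def RatMap.HasDynamicalDegree (F : RatMap K) (δ : ℝ) : Prop :=
  ∃ it : ℕ → RatMap K, it 0 = F ∧ (∀ m, F.IsComp (it m) (it (m + 1))) ∧
    Tendsto (fun m : ℕ => ((it m).degree : ℝ) ^ (1 / ((m : ℝ) + 1))) atTop (𝓝 δ)

/-! ### Homogenization -/

/-- `Z^d p(X/Z, Y/Z)`, for `d` at least the total degree of `p`. -/
def homogenize (d : ℕ) (p : MvPolynomial (Fin 2) K) : MvPolynomial (Fin 3) K :=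
  ∑ m ∈ p.support, C (p.coeff m) * (X 0 ^ m 0 * X 1 ^ m 1 * X 2 ^ (d - (m 0 + m 1)))

theorem homogenize_isHomogeneous {d : ℕ} {p : MvPolynomial (Fin 2) K} (h : p.totalDegree ≤ d) :
    (homogenize d p).IsHomogeneous d := by
  refine IsHomogeneous.sum _ _ _ fun m hm => ?_
  have h1 : m 0 + m 1 ≤ d := by
    have h2 := le_totalDegree hm
    rw [Finsupp.sum_fintype _ _ (fun _ => rfl), Fin.sum_univ_two] at h2
    exact h2.trans h
  have h3 := (isHomogeneous_C (Fin 3) (p.coeff m)).mul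
    ((((isHomogeneous_X K (0 : Fin 3)).pow (m 0)).mul ((isHomogeneous_X K (1 : Fin 3)).pow (m 1))).mul
      ((isHomogeneous_X K (2 : Fin 3)).pow (d - (m 0 + m 1))))
  convert h3 using 1
  omega

/-- The rational map `[Z^d P(X/Z, Y/Z), Z^d Q(X/Z, Y/Z), Z^d]`, with `d` the larger one of the
total degrees of `P` and `Q`. -/
def homogenization (F : AffMap K) : RatMap K where
  deg := max (F 0).totalDegree (F 1).totalDegree
  coord :=
    let d := max (F 0).totalDegree (F 1).totalDegree
    ![homogenize d (F 0), homogenize d (F 1), X 2 ^ d]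
  homog := by
    intro i
    fin_cases i
    · exact homogenize_isHomogeneous (le_max_left _ _)
    · exact homogenize_isHomogeneous (le_max_right _ _)
    · simpa using (isHomogeneous_X K (2 : Fin 3)).pow (max (F 0).totalDegree (F 1).totalDegree)
  exists_ne_zero := ⟨2, by simp⟩

/-- The point `[0,1,0]`. -/
def pt010 (K : Type*) [Field K] : ℙ K (Fin 3 → K) :=
  Projectivization.mk K ![0, 1, 0] (fun h => one_ne_zero (congrFun h 1))

/-- The point `[1,0,0]`. -/
def pt100 (K : Type*) [Field K] : ℙ K (Fin 3 → K) :=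
  Projectivization.mk K ![1, 0, 0] (fun h => one_ne_zero (congrFun h 0))

end Folding

end

namespace Folding

/-! ### Values of the recursive sequences -/

section Sequences

variable {S T : Type*} [CommRing S] [CommRing T]

/-! In suitable torus coordinates the orbit sums are symmetric functions, and `t ↦ t ^ n` raises
their arguments to the `n`th power. For `A_2` the arguments are `p, q, r` with `pqr = 1`, and `z,
z̄` are their elementary symmetric functions `e₁, e₂`, so `A_n` consists of power sums
(`powerSum₃_eq`). For `B_2` the orbit sums are `a + b` and `ab` with `a = u + u⁻¹`, `b = v + v⁻¹`,
so `B_n` comes from two Dickson polynomials (`seqB_eq`). For `G_2` they are `z + w` and `zw - 3`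
with `z, w` as for `A_2` (`seqG_fst`); the long weights give a second such system, which reduces the
second component to the first (`seqG_snd`). Uniqueness holds because `Φ` is surjective: its fibres
are found by solving quadratic and cubic equations.

The homogenization has third coordinate `Z^d`, and `Z` does not divide the component of degree `d >
0`; hence the presentation is reduced (`exists_eq_mul_of_same`). Its degree is therefore `d`, and
its indeterminacy points are the common zeros, on `Z = 0`, of the two forms of degree `d`.

It remains to follow leading forms through the recursions. For `A_n` they are combinations of `(x +
iy)^n` and `(x - iy)^n`; for `B_n` the first is `x^n` and the second restricts to `y^n` on `x = 0`.
In both cases the only common zero is the origin. For `G_n` with `n ≥ 2` only the second component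
reaches the top degree, with form `2(-x³)^m` for `n = 2m` and `(2m+1)(-x³)^m y` for `n = 2m+1`
(`hasLead_foldG_snd`).

Uniqueness also gives `G_n ∘ G_m = G_{mn}` (`bind₁_foldG`). The `m`th iterate of `G_n` thus has
degree `⌊3n^m/2⌋`, whose `m`th root tends to `n`. -/

theorem map_seqA (f : S →+* T) (x y : S) :
    ∀ n k, f (seqA x y n k) = seqA (f x) (f y) n k
  | 0, k => by fin_cases k <;> simp [seqA, map_ofNat]
  | 1, k => by fin_cases k <;> simp [seqA]
  | 2, k => by fin_cases k <;> simp [seqA, map_ofNat]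
  | n + 3, k => by
    fin_cases k <;> simp [seqA, map_seqA f x y n, map_seqA f x y (n + 1), map_seqA f x y (n + 2)]

theorem map_seqB (f : S →+* T) (x y : S) :
    ∀ n k, f (seqB x y n k) = seqB (f x) (f y) n k
  | 0, k => by fin_cases k <;> simp [seqB, map_ofNat]
  | 1, k => by fin_cases k <;> simp [seqB]
  | 2, k => by fin_cases k <;> simp [seqB, map_ofNat]
  | 3, k => by fin_cases k <;> simp [seqB, map_ofNat]
  | n + 4, k => by
    fin_cases k <;> simp [seqB, map_ofNat, map_seqB f x y n, map_seqB f x y (n + 1),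
      map_seqB f x y (n + 2),
      map_seqB f x y (n + 3)]

theorem map_seqG (f : S →+* T) (x y : S) :
    ∀ n k, f (seqG x y n k) = seqG (f x) (f y) n k
  | 0, k => by fin_cases k <;> simp [seqG, map_ofNat]
  | 1, k => by fin_cases k <;> simp [seqG]
  | 2, k => by fin_cases k <;> simp [seqG, map_ofNat]
  | 3, k => by fin_cases k <;> simp [seqG, map_ofNat]
  | 4, k => by fin_cases k <;> simp [seqG, map_ofNat]
  | 5, k => by fin_cases k <;> simp [seqG, map_ofNat]
  | n + 6, k => by
    fin_cases k <;> simp [seqG, map_ofNat, map_seqG f x y n, map_seqG f x y (n + 1),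
      map_seqG f x y (n + 2),
      map_seqG f x y (n + 3), map_seqG f x y (n + 4), map_seqG f x y (n + 5)]

/-- The power sums of three elements with product `1`, in terms of the first two elementary
symmetric functions. -/
def powerSum₃ (z w : S) : ℕ → S
  | 0 => 3
  | 1 => z
  | 2 => z ^ 2 - 2 * w
  | n + 3 => z * powerSum₃ z w (n + 2) - w * powerSum₃ z w (n + 1) + powerSum₃ z w n

/-- Each of `p, q, r` is a root of `T³ - zT² + wT - 1`; multiplying by its `n`th power and summing
gives the recursion. -/
theorem powerSum₃_eq {p q r z w : S} (h : p * q * r = 1) (hz : z = p + q + r)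
    (hw : w = p * q + q * r + r * p) : ∀ n, powerSum₃ z w n = p ^ n + q ^ n + r ^ n
  | 0 => by simp [powerSum₃]; norm_num
  | 1 => by simp [powerSum₃, hz]
  | 2 => by simp only [powerSum₃, hz, hw]; ring
  | n + 3 => by
    rw [powerSum₃, powerSum₃_eq h hz hw n, powerSum₃_eq h hz hw (n + 1),
      powerSum₃_eq h hz hw (n + 2), hz, hw]
    linear_combination -(p ^ n + q ^ n + r ^ n) * h

/-- The products `pq, qr, rp` are the inverses of `r, p, q`. Passing to them exchanges the two
elementary symmetric functions. -/
theorem powerSum₃_swap_eq {p q r z w : S} (h : p * q * r = 1) (hz : z = p + q + r)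
    (hw : w = p * q + q * r + r * p) (n : ℕ) :
    powerSum₃ w z n = (p * q) ^ n + (q * r) ^ n + (r * p) ^ n :=
  powerSum₃_eq (by linear_combination (p * q * r + 1) * h) hw
    (by linear_combination hz - (p + q + r) * h) n

/-- Any square root of `-1` is allowed. Using both `i` and `-i` gives the conjugate identity as
well, and the two together determine both components. -/
theorem seqA_add_mul {i : S} (hi : i ^ 2 = -1) (x y : S) :
    ∀ n, seqA x y n 0 + i * seqA x y n 1 = powerSum₃ (x + i * y) (x - i * y) n
  | 0 => by simp [seqA, powerSum₃]
  | 1 => by simp [seqA, powerSum₃]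
  | 2 => by simp [seqA, powerSum₃]; linear_combination -y ^ 2 * hi
  | n + 3 => by
    rw [powerSum₃, ← seqA_add_mul hi x y n, ← seqA_add_mul hi x y (n + 1),
      ← seqA_add_mul hi x y (n + 2)]
    simp only [seqA, Matrix.cons_val_zero, Matrix.cons_val_one]
    linear_combination (-y * seqA x y (n + 2) 1 - y * seqA x y (n + 1) 1) * hi

/-- The Dickson polynomial `uⁿ + u⁻ⁿ` in `a = u + u⁻¹`. -/
def dicksonVal (a : S) : ℕ → S
  | 0 => 2
  | 1 => a
  | n + 2 => a * dicksonVal a (n + 1) - dicksonVal a n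

theorem dicksonVal_eq {u v a : S} (h : u * v = 1) (ha : a = u + v) :
    ∀ n, dicksonVal a n = u ^ n + v ^ n
  | 0 => by simp [dicksonVal]; norm_num
  | 1 => by simp [dicksonVal, ha]
  | n + 2 => by
    rw [dicksonVal, dicksonVal_eq h ha n, dicksonVal_eq h ha (n + 1), ha]
    linear_combination (u ^ n + v ^ n) * h

/-- With `a = u + u⁻¹` and `b = v + v⁻¹`, the first recursion has characteristic polynomial `(T² -
aT + 1)(T² - bT + 1)`. The second has the roots `u^{±1}v^{±1}`; its middle coefficient is `a² + b² -
2 = x² - 2y - 2`. -/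
theorem seqB_eq (a b : S) : ∀ n, seqB (a + b) (a * b) n 0 = dicksonVal a n + dicksonVal b n ∧
    seqB (a + b) (a * b) n 1 = dicksonVal a n * dicksonVal b n
  | 0 => by simp [seqB, dicksonVal]; norm_num
  | 1 => by simp [seqB, dicksonVal]
  | 2 => by simp [seqB, dicksonVal]; constructor <;> ring
  | 3 => by simp [seqB, dicksonVal]; constructor <;> ring
  | n + 4 => by
    obtain ⟨h0, k0⟩ := seqB_eq a b n
    obtain ⟨h1, k1⟩ := seqB_eq a b (n + 1)
    obtain ⟨h2, k2⟩ := seqB_eq a b (n + 2)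
    obtain ⟨h3, k3⟩ := seqB_eq a b (n + 3)
    simp only [seqB, Matrix.cons_val_zero, Matrix.cons_val_one, h0, h1, h2, h3, k0, k1, k2, k3,
      dicksonVal]
    constructor <;> ring

/-- The characteristic polynomial of the recursion is `(T³ - zT² + wT - 1)(T³ - wT² + zT - 1)`,
written in `x = z + w` and `y = zw - 3`. -/
theorem seqG_fst (z w : S) : ∀ n,
    seqG (z + w) (z * w - 3) n 0 = powerSum₃ z w n + powerSum₃ w z n
  | 0 => by simp [seqG, powerSum₃]; norm_num
  | 1 => by simp [seqG, powerSum₃]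
  | 2 => by simp [seqG, powerSum₃]; ring
  | 3 => by simp [seqG, powerSum₃]; ring
  | 4 => by simp [seqG, powerSum₃]; ring
  | 5 => by simp [seqG, powerSum₃]; ring
  | n + 6 => by
    simp only [seqG, Matrix.cons_val_zero, seqG_fst z w n, seqG_fst z w (n + 1),
      seqG_fst z w (n + 2), seqG_fst z w (n + 3), seqG_fst z w (n + 4), seqG_fst z w (n + 5),
      powerSum₃]
    ring

/-- The long roots of `G₂` form a system of type `A₂` just as the short roots do. -/
theorem seqG_snd (x y : S) : ∀ n, seqG x y n 1 = seqG y (seqG x y 3 0) n 0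
  | 0 => by simp [seqG]
  | 1 => by simp [seqG]
  | 2 => by simp [seqG]; ring
  | 3 => by simp [seqG]; ring
  | 4 => by simp [seqG]; ring
  | 5 => by simp [seqG]; ring
  | n + 6 => by
    -- The second recursion is the first with `(x, y)` replaced by `(y, X₃)`: its coefficients are
    -- `y + X₃ + 3` and `y² - 2X₃ - 4`. Here `seqG.eq_7` is the general step, and `seqG.eq_4` below
    -- gives `X₃`.
    simp only [seqG.eq_7, Matrix.cons_val_zero, Matrix.cons_val_one, seqG_snd x y n,
      seqG_snd x y (n + 1), seqG_snd x y (n + 2), seqG_snd x y (n + 3), seqG_snd x y (n + 4),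
      seqG_snd x y (n + 5)]
    simp only [seqG.eq_4, Matrix.cons_val_zero]
    ring

end Sequences

/-! ### Leading forms -/

/-- In a product of monomials of total degree `a + b`, a split other than `(a, b)` exceeds one of
the two bounds. Only bounds are assumed, so either component may vanish. -/
theorem homogeneousComponent_add_mul {σ R : Type*} [CommRing R] {p q : MvPolynomial σ R}
    {a b : ℕ} (hp : p.totalDegree ≤ a) (hq : q.totalDegree ≤ b) :
    homogeneousComponent (a + b) (p * q) =
      homogeneousComponent a p * homogeneousComponent b q := by
  classical
  ext m
  by_cases hm : m.degree = a + b
  · rw [coeff_homogeneousComponent, if_pos hm, coeff_mul, coeff_mul]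
    refine Finset.sum_congr rfl fun x hx => ?_
    rw [Finset.HasAntidiagonal.mem_antidiagonal] at hx
    have hd : x.1.degree + x.2.degree = a + b := by rw [← map_add, hx, hm]
    rw [coeff_homogeneousComponent, coeff_homogeneousComponent]
    rcases lt_trichotomy x.1.degree a with h | h | h
    · rw [if_neg h.ne, zero_mul, coeff_eq_zero_of_totalDegree_lt (f := q), mul_zero]
      change q.totalDegree < x.2.degree
      omega
    · rw [if_pos h, if_pos (by omega)]
    · rw [if_neg h.ne', zero_mul, coeff_eq_zero_of_totalDegree_lt (f := p), zero_mul]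
      change p.totalDegree < x.1.degree
      omega
  · rw [coeff_homogeneousComponent, if_neg hm]
    refine (((homogeneousComponent_isHomogeneous a p).mul
      (homogeneousComponent_isHomogeneous b q)).coeff_eq_zero ?_).symm
    exact hm

theorem totalDegree_lt_of_homogeneousComponent_eq_zero {σ R : Type*} [CommRing R]
    {p : MvPolynomial σ R} {d : ℕ} (hd : 0 < d) (hp : p.totalDegree ≤ d)
    (h : homogeneousComponent d p = 0) : p.totalDegree < d := by
  rw [totalDegree, Finset.sup_lt_iff hd]
  intro m hm
  refine lt_of_le_of_ne ((le_totalDegree hm).trans hp) fun hmd => ?_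
  have h1 := coeff_homogeneousComponent d p m
  rw [if_pos (show m.degree = d from hmd), h, coeff_zero] at h1
  exact (mem_support_iff.mp hm) h1.symm

section Leading

variable {K : Type*} [Field K]

theorem totalDegree_add_le {σ : Type*} {p q : MvPolynomial σ K} {d : ℕ}
    (hp : p.totalDegree ≤ d) (hq : q.totalDegree ≤ d) : (p + q).totalDegree ≤ d :=
  (totalDegree_add p q).trans (max_le hp hq)

theorem totalDegree_sub_le {σ : Type*} {p q : MvPolynomial σ K} {d : ℕ}
    (hp : p.totalDegree ≤ d) (hq : q.totalDegree ≤ d) : (p - q).totalDegree ≤ d :=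
  (totalDegree_sub p q).trans (max_le hp hq)

theorem totalDegree_mul_le {σ : Type*} {p q : MvPolynomial σ K} {a b d : ℕ}
    (hp : p.totalDegree ≤ a) (hq : q.totalDegree ≤ b) (h : a + b ≤ d) :
    (p * q).totalDegree ≤ d :=
  (totalDegree_mul p q).trans ((add_le_add hp hq).trans h)

theorem totalDegree_ofNat {σ : Type*} (n : ℕ) [n.AtLeastTwo] :
    (OfNat.ofNat n : MvPolynomial σ K).totalDegree = 0 := by
  rw [← map_ofNat C n, totalDegree_C]

/-- `p` has degree at most `d`, and its form of degree `d` takes the value `c` at `v`. -/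
def HasLead (v : Fin 2 → K) (d : ℕ) (p : MvPolynomial (Fin 2) K) (c : K) : Prop :=
  p.totalDegree ≤ d ∧ eval v (homogeneousComponent d p) = c

namespace HasLead

variable {v : Fin 2 → K} {d e : ℕ} {p q : MvPolynomial (Fin 2) K} {a b : K}

theorem add (hp : HasLead v d p a) (hq : HasLead v d q b) : HasLead v d (p + q) (a + b) :=
  ⟨totalDegree_add_le hp.1 hq.1, by rw [map_add, map_add, hp.2, hq.2]⟩

theorem sub (hp : HasLead v d p a) (hq : HasLead v d q b) : HasLead v d (p - q) (a - b) :=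
  ⟨totalDegree_sub_le hp.1 hq.1, by rw [map_sub, map_sub, hp.2, hq.2]⟩

theorem mul (hp : HasLead v d p a) (hq : HasLead v e q b) : HasLead v (d + e) (p * q) (a * b) :=
  ⟨totalDegree_mul_le hp.1 hq.1 le_rfl, by
    rw [homogeneousComponent_add_mul hp.1 hq.1, map_mul, hp.2, hq.2]⟩

theorem of_lt (h : p.totalDegree < d) : HasLead v d p 0 :=
  ⟨h.le, by rw [homogeneousComponent_eq_zero _ _ h, map_zero]⟩

theorem const_mul (hp : HasLead v d p a) (c : K) : HasLead v d (C c * p) (c * a) :=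
  ⟨totalDegree_mul_le (totalDegree_C c).le hp.1 (zero_add d).le, by
    rw [homogeneousComponent_C_mul, map_mul, eval_C, hp.2]⟩

theorem X (i : Fin 2) : HasLead v 1 (MvPolynomial.X i) (v i) :=
  ⟨(totalDegree_X i).le, by
    rw [homogeneousComponent_eq_self (isHomogeneous_X K i), eval_X]⟩

theorem pow (hp : HasLead v d p a) : ∀ n : ℕ, HasLead v (n * d) (p ^ n) (a ^ n)
  | 0 => by
    rw [Nat.zero_mul]
    exact ⟨by simp, by simp⟩
  | n + 1 => by
    rw [pow_succ, pow_succ, Nat.succ_mul]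
    exact (hp.pow n).mul hp

theorem totalDegree_eq (hp : HasLead v d p a) (ha : a ≠ 0) : p.totalDegree = d := by
  refine hp.1.antisymm (not_lt.mp fun h => ha ?_)
  rw [← hp.2, homogeneousComponent_eq_zero _ _ h, map_zero]

end HasLead

/-! ### Homogenization -/

theorem eval_homogenize {d : ℕ} {p : MvPolynomial (Fin 2) K} (h : p.totalDegree ≤ d)
    {v : Fin 3 → K} (hv : v 2 ≠ 0) :
    eval v (homogenize d p) = v 2 ^ d * eval ![v 0 / v 2, v 1 / v 2] p := by
  rw [homogenize, map_sum, eval_eq', Finset.mul_sum]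
  refine Finset.sum_congr rfl fun m hm => ?_
  have h1 : m 0 + m 1 ≤ d := by
    have h2 := le_totalDegree hm
    rw [Finsupp.sum_fintype _ _ (fun _ => rfl), Fin.sum_univ_two] at h2
    exact h2.trans h
  obtain ⟨k, rfl⟩ := Nat.exists_eq_add_of_le h1
  simp only [map_mul, map_pow, eval_C, eval_X, Fin.prod_univ_two, Nat.add_sub_cancel_left,
    Matrix.cons_val_zero, Matrix.cons_val_one, div_pow, pow_add]
  field_simp

/-- On `Z = 0` exactly the monomials without a factor `Z` survive, and these come from the terms of
degree `d`. -/
theorem eval_homogenize_infinity {d : ℕ} {p : MvPolynomial (Fin 2) K} (h : p.totalDegree ≤ d)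
    {v : Fin 3 → K} (hv : v 2 = 0) :
    eval v (homogenize d p) = eval ![v 0, v 1] (homogeneousComponent d p) := by
  rw [homogenize, map_sum, homogeneousComponent_apply, map_sum, Finset.sum_filter]
  refine Finset.sum_congr rfl fun m hm => ?_
  have hdeg : m.degree = m 0 + m 1 := by rw [Finsupp.degree_eq_sum, Fin.sum_univ_two]
  have h1 : m.degree ≤ d := (le_totalDegree hm).trans h
  simp only [map_mul, map_pow, eval_C, eval_X, hv]
  split_ifs with hmd
  · rw [eval_monomial, Finsupp.prod_fintype _ _ (fun _ => pow_zero _), Fin.prod_univ_two]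
    simp [← hdeg, hmd]
  · rw [zero_pow (by omega), mul_zero, mul_zero]

/-- Divisibility by `Z` would make the leading form vanish at every point, hence be zero over an
infinite field. -/
theorem not_X_dvd_homogenize [Infinite K] {p : MvPolynomial (Fin 2) K} (h : 0 < p.totalDegree) :
    ¬ (X 2 : MvPolynomial (Fin 3) K) ∣ homogenize p.totalDegree p := by
  rintro ⟨q, hq⟩
  refine (totalDegree_lt_of_homogeneousComponent_eq_zero h le_rfl ?_).false
  refine MvPolynomial.funext fun v => ?_
  have h1 := eval_homogenize_infinity (K := K) (p := p) le_rfl (v := ![v 0, v 1, 0]) rfl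
  rw [hq, map_mul, eval_X] at h1
  have h2 : ![v 0, v 1] = v := by ext i; fin_cases i <;> rfl
  simpa [h2] using h1.symm

theorem homogenization_coord_two (F : AffMap K) :
    (homogenization F).coord 2 = X 2 ^ (homogenization F).deg := rfl

theorem homogenization_deg (F : AffMap K) :
    (homogenization F).deg = max (F 0).totalDegree (F 1).totalDegree := rfl

/-- Proportionality gives `F_i G_2 = Z^d G_i`. For the component attaining the degree `d`, the prime
`Z` does not divide `F_i`, so all of `Z^d` divides `G_2`. -/
theorem X_pow_dvd_of_same [Infinite K] {F : AffMap K} {G : RatMap K}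
    (h : (homogenization F).Same G) : X 2 ^ (homogenization F).deg ∣ G.coord 2 := by
  rcases Nat.eq_zero_or_pos (homogenization F).deg with hd | hd
  · rw [hd, pow_zero]
    exact one_dvd _
  have h0 : X 2 ^ (homogenization F).deg ∣ (homogenization F).coord 0 * G.coord 2 :=
    ⟨_, by rw [h 0 2, homogenization_coord_two]⟩
  have h1 : X 2 ^ (homogenization F).deg ∣ (homogenization F).coord 1 * G.coord 2 :=
    ⟨_, by rw [h 1 2, homogenization_coord_two]⟩
  rcases max_choice (F 0).totalDegree (F 1).totalDegree with hm | hm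
  · refine X_prime.pow_dvd_of_dvd_mul_left _ ?_ h0
    change ¬ X 2 ∣ homogenize (max (F 0).totalDegree (F 1).totalDegree) (F 0)
    rw [hm]
    exact not_X_dvd_homogenize (by rwa [homogenization_deg, hm] at hd)
  · refine X_prime.pow_dvd_of_dvd_mul_left _ ?_ h1
    change ¬ X 2 ∣ homogenize (max (F 0).totalDegree (F 1).totalDegree) (F 1)
    rw [hm]
    exact not_X_dvd_homogenize (by rwa [homogenization_deg, hm] at hd)

/-- The homogenization of an affine map is a presentation without common factors: every other
presentation is a multiple of it. -/
theorem exists_eq_mul_of_same [Infinite K] {F : AffMap K} {G : RatMap K}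
    (h : (homogenization F).Same G) :
    ∃ H : MvPolynomial (Fin 3) K, H ≠ 0 ∧ ∀ i, G.coord i = (homogenization F).coord i * H := by
  obtain ⟨H, hH⟩ := X_pow_dvd_of_same h
  have hX : (X 2 ^ (homogenization F).deg : MvPolynomial (Fin 3) K) ≠ 0 :=
    pow_ne_zero _ (X_ne_zero _)
  have hG : ∀ i, G.coord i = (homogenization F).coord i * H := fun i => by
    refine mul_left_cancel₀ hX ?_
    rw [← homogenization_coord_two, ← h i 2, hH, ← homogenization_coord_two]
    ring
  refine ⟨H, ?_, hG⟩
  rintro rfl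
  obtain ⟨i, hi⟩ := G.exists_ne_zero
  exact hi (by rw [hG i, mul_zero])

theorem RatMap.same_refl (F : RatMap K) : F.Same F := fun _ _ => mul_comm _ _

theorem degree_homogenization [Infinite K] (F : AffMap K) :
    (homogenization F).degree = max (F 0).totalDegree (F 1).totalDegree := by
  refine le_antisymm (Nat.sInf_le ⟨homogenization F, RatMap.same_refl _, rfl⟩) ?_
  refine le_csInf ⟨_, homogenization F, RatMap.same_refl _, rfl⟩ ?_
  rintro _ ⟨G, hG, rfl⟩
  obtain ⟨H, hH, h⟩ := exists_eq_mul_of_same hG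
  have hX : (X 2 ^ (homogenization F).deg : MvPolynomial (Fin 3) K) ≠ 0 :=
    pow_ne_zero _ (X_ne_zero _)
  have h2 := h 2
  rw [homogenization_coord_two] at h2
  have h3 := (G.homog 2).totalDegree (by rw [h2]; exact mul_ne_zero hX hH)
  rw [h2, totalDegree_mul_of_isDomain hX hH, totalDegree_X_pow] at h3
  rw [← homogenization_deg]
  omega

theorem mem_indeterminacy_homogenization [Infinite K] (F : AffMap K)
    (p : ℙ K (Fin 3 → K)) : p ∈ (homogenization F).indeterminacy ↔
      ∀ i, eval p.rep ((homogenization F).coord i) = 0 := by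
  refine ⟨fun h => h _ (RatMap.same_refl _), fun h G hG i => ?_⟩
  obtain ⟨H, -, hH⟩ := exists_eq_mul_of_same hG
  rw [hH i, map_mul, h i, zero_mul]

/-- Vanishing of `Z^d` with `d > 0` puts the point on the line at infinity, where the other
coordinates are the forms of degree `d`. -/
theorem mem_indeterminacy_homogenization_of_pos [Infinite K] {F : AffMap K} {d : ℕ}
    (hF : max (F 0).totalDegree (F 1).totalDegree = d) (hd : 0 < d) (p : ℙ K (Fin 3 → K)) :
    p ∈ (homogenization F).indeterminacy ↔ p.rep 2 = 0 ∧
      ∀ k, eval ![p.rep 0, p.rep 1] (homogeneousComponent d (F k)) = 0 := by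
  have h0 : (F 0).totalDegree ≤ d := hF ▸ le_max_left _ _
  have h1 : (F 1).totalDegree ≤ d := hF ▸ le_max_right _ _
  have hc0 : (homogenization F).coord 0 = homogenize d (F 0) := by rw [← hF]; rfl
  have hc1 : (homogenization F).coord 1 = homogenize d (F 1) := by rw [← hF]; rfl
  rw [mem_indeterminacy_homogenization, Fin.forall_fin_succ, Fin.forall_fin_two,
    Fin.forall_fin_two]
  change eval p.rep ((homogenization F).coord 0) = 0 ∧
    eval p.rep ((homogenization F).coord 1) = 0 ∧ eval p.rep ((homogenization F).coord 2) = 0 ↔ _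
  rw [hc0, hc1, homogenization_coord_two, homogenization_deg, hF, map_pow, eval_X,
    pow_eq_zero_iff hd.ne']
  constructor
  · rintro ⟨ha, hb, hz⟩
    rw [eval_homogenize_infinity h0 hz] at ha
    rw [eval_homogenize_infinity h1 hz] at hb
    exact ⟨hz, ha, hb⟩
  · rintro ⟨hz, ha, hb⟩
    rw [eval_homogenize_infinity h0 hz, eval_homogenize_infinity h1 hz]
    exact ⟨ha, hb, hz⟩

theorem isMorphism_homogenization_of_eq_zero [Infinite K] {F : AffMap K}
    (hF : max (F 0).totalDegree (F 1).totalDegree = 0) : (homogenization F).IsMorphism := by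
  refine Set.eq_empty_of_forall_notMem fun p hp => ?_
  rw [mem_indeterminacy_homogenization] at hp
  have h2 := hp 2
  rw [homogenization_coord_two, homogenization_deg, hF, pow_zero, map_one] at h2
  exact one_ne_zero h2

theorem isMorphism_homogenization [Infinite K] {F : AffMap K} {d : ℕ}
    (hF : max (F 0).totalDegree (F 1).totalDegree = d) (hd : 0 < d)
    (h : ∀ v : Fin 2 → K, (∀ k, eval v (homogeneousComponent d (F k)) = 0) → v = 0) :
    (homogenization F).IsMorphism := by
  refine Set.eq_empty_of_forall_notMem fun p hp => p.rep_nonzero ?_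
  rw [mem_indeterminacy_homogenization_of_pos hF hd] at hp
  have h1 := h _ hp.2
  ext i
  fin_cases i
  · exact congrFun h1 0
  · exact congrFun h1 1
  · exact hp.1

/-- In the affine chart, composing homogenizations is composing affine maps, up to a scalar common
to the three coordinates. -/
theorem eval_bind₁_homogenization_coord {F G : AffMap K} {v : Fin 3 → K} (hv : v 2 ≠ 0)
    (i : Fin 3) : eval v (bind₁ (homogenization G).coord ((homogenization F).coord i)) =
      (v 2 ^ (homogenization G).deg) ^ (homogenization F).deg *
        ![eval ![v 0 / v 2, v 1 / v 2] (bind₁ G (F 0)),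
          eval ![v 0 / v 2, v 1 / v 2] (bind₁ G (F 1)), 1] i := by
  have hc : (fun j => eval v ((homogenization G).coord j)) 2 =
      v 2 ^ (homogenization G).deg := by
    simp [homogenization_coord_two]
  have hc0 : (fun j => eval v ((homogenization G).coord j)) 0 =
      v 2 ^ (homogenization G).deg * eval ![v 0 / v 2, v 1 / v 2] (G 0) :=
    eval_homogenize (le_max_left _ _) hv
  have hc1 : (fun j => eval v ((homogenization G).coord j)) 1 =
      v 2 ^ (homogenization G).deg * eval ![v 0 / v 2, v 1 / v 2] (G 1) :=
    eval_homogenize (le_max_right _ _) hv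
  have hne : v 2 ^ (homogenization G).deg ≠ 0 := pow_ne_zero _ hv
  have hb : ∀ (w : Fin 2 → K) (p : MvPolynomial (Fin 2) K),
      eval w (bind₁ G p) = eval ![eval w (G 0), eval w (G 1)] p := fun w p => by
    rw [eval, eval₂Hom_bind₁]
    congr 2
    ext k
    fin_cases k <;> rfl
  rw [eval, eval₂Hom_bind₁]
  change eval (fun j => eval v ((homogenization G).coord j)) ((homogenization F).coord i) = _
  generalize (fun j => eval v ((homogenization G).coord j)) = w at hc hc0 hc1 ⊢
  have hw : w 2 ≠ 0 := hc ▸ hne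
  have hdiv : ![w 0 / w 2, w 1 / w 2] = ![eval ![v 0 / v 2, v 1 / v 2] (G 0),
      eval ![v 0 / v 2, v 1 / v 2] (G 1)] := by
    rw [hc, hc0, hc1, mul_div_cancel_left₀ _ hne, mul_div_cancel_left₀ _ hne]
  rw [hb, hb, ← hdiv, ← hc]
  fin_cases i
  · exact eval_homogenize (le_max_left _ _) hw
  · exact eval_homogenize (le_max_right _ _) hw
  · simp [homogenization_coord_two]

/-- The third coordinate of the composite is a power of `Z`, hence nonzero. So the composition
exists whatever the indeterminacy loci are. -/
theorem isComp_homogenization [Infinite K] {F G H : AffMap K} (h : ∀ k, bind₁ G (F k) = H k) :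
    (homogenization F).IsComp (homogenization G) (homogenization H) := by
  refine ⟨homogenization F, RatMap.same_refl _, ⟨2, ?_⟩, fun i j => ?_⟩
  · rw [homogenization_coord_two, map_pow, bind₁_X_right, homogenization_coord_two]
    exact pow_ne_zero _ (pow_ne_zero _ (X_ne_zero _))
  -- After multiplication by `Z` the identity is trivial on `Z = 0` and needs checking only in the
  -- affine chart.
  · refine mul_left_cancel₀ (X_ne_zero (R := K) (2 : Fin 3)) (MvPolynomial.funext fun v => ?_)
    simp only [map_mul, eval_X]
    rcases eq_or_ne (v 2) 0 with hv | hv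
    · rw [hv, zero_mul, zero_mul]
    have hH : ∀ i, eval v ((homogenization H).coord i) = v 2 ^ (homogenization H).deg *
        ![eval ![v 0 / v 2, v 1 / v 2] (H 0), eval ![v 0 / v 2, v 1 / v 2] (H 1), 1] i :=
      fun i => by
        fin_cases i
        · exact eval_homogenize (le_max_left _ _) hv
        · exact eval_homogenize (le_max_right _ _) hv
        · simp [homogenization_coord_two]
    rw [hH, hH, eval_bind₁_homogenization_coord hv, eval_bind₁_homogenization_coord hv, h, h]
    ring

end Leading

/-! ### Weyl group orbits -/

theorem weylOrbit_eq_of_closed {C : Matrix (Fin 2) (Fin 2) ℤ} {v : Fin 2 → ℤ}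
    (s : Finset (Fin 2 → ℤ)) (hv : v ∈ s) (hs : ∀ w ∈ s, ∀ i, simpleReflection C i w ∈ s)
    (h : ∀ w ∈ s, w ∈ weylOrbit C v) : weylOrbit C v = s := by
  refine Set.Subset.antisymm (fun w hw => ?_) h
  induction hw with
  | refl => exact hv
  | tail _ hbc ih =>
    obtain ⟨i, rfl⟩ := hbc
    exact hs _ ih i

theorem simpleReflection_mem_weylOrbit {C : Matrix (Fin 2) (Fin 2) ℤ} {v w w' : Fin 2 → ℤ}
    (hw : w ∈ weylOrbit C v) (i : Fin 2) (h : simpleReflection C i w = w') :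
    w' ∈ weylOrbit C v :=
  Relation.ReflTransGen.tail hw ⟨i, h.symm⟩

theorem weylOrbit_cartanA_zero : weylOrbit cartanA (Pi.single 0 1) =
    (({![1, 0], ![-1, 1], ![0, -1]} : Finset (Fin 2 → ℤ)) : Set (Fin 2 → ℤ)) := by
  have h0 : ![1, 0] ∈ weylOrbit cartanA (Pi.single 0 1) := by
    rw [show (![1, 0] : Fin 2 → ℤ) = Pi.single 0 1 by decide]; exact .refl
  have h1 := simpleReflection_mem_weylOrbit h0 0 (w' := ![-1, 1]) (by decide)
  have h2 := simpleReflection_mem_weylOrbit h1 1 (w' := ![0, -1]) (by decide)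
  refine weylOrbit_eq_of_closed _ (by decide) (by decide) ?_
  simp [h0, h1, h2]

theorem weylOrbit_cartanA_one : weylOrbit cartanA (Pi.single 1 1) =
    (({![0, 1], ![1, -1], ![-1, 0]} : Finset (Fin 2 → ℤ)) : Set (Fin 2 → ℤ)) := by
  have h0 : ![0, 1] ∈ weylOrbit cartanA (Pi.single 1 1) := by
    rw [show (![0, 1] : Fin 2 → ℤ) = Pi.single 1 1 by decide]; exact .refl
  have h1 := simpleReflection_mem_weylOrbit h0 1 (w' := ![1, -1]) (by decide)
  have h2 := simpleReflection_mem_weylOrbit h1 0 (w' := ![-1, 0]) (by decide)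
  refine weylOrbit_eq_of_closed _ (by decide) (by decide) ?_
  simp [h0, h1, h2]

theorem weylOrbit_cartanB_zero : weylOrbit cartanB (Pi.single 0 1) =
    (({![1, 0], ![-1, 1], ![1, -1], ![-1, 0]} : Finset (Fin 2 → ℤ)) : Set (Fin 2 → ℤ)) := by
  have h0 : ![1, 0] ∈ weylOrbit cartanB (Pi.single 0 1) := by
    rw [show (![1, 0] : Fin 2 → ℤ) = Pi.single 0 1 by decide]; exact .refl
  have h1 := simpleReflection_mem_weylOrbit h0 0 (w' := ![-1, 1]) (by decide)
  have h2 := simpleReflection_mem_weylOrbit h1 1 (w' := ![1, -1]) (by decide)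
  have h3 := simpleReflection_mem_weylOrbit h2 0 (w' := ![-1, 0]) (by decide)
  refine weylOrbit_eq_of_closed _ (by decide) (by decide) ?_
  simp [h0, h1, h2, h3]

theorem weylOrbit_cartanB_one : weylOrbit cartanB (Pi.single 1 1) =
    (({![0, 1], ![2, -1], ![-2, 1], ![0, -1]} : Finset (Fin 2 → ℤ)) : Set (Fin 2 → ℤ)) := by
  have h0 : ![0, 1] ∈ weylOrbit cartanB (Pi.single 1 1) := by
    rw [show (![0, 1] : Fin 2 → ℤ) = Pi.single 1 1 by decide]; exact .refl
  have h1 := simpleReflection_mem_weylOrbit h0 1 (w' := ![2, -1]) (by decide)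
  have h2 := simpleReflection_mem_weylOrbit h1 0 (w' := ![-2, 1]) (by decide)
  have h3 := simpleReflection_mem_weylOrbit h2 1 (w' := ![0, -1]) (by decide)
  refine weylOrbit_eq_of_closed _ (by decide) (by decide) ?_
  simp [h0, h1, h2, h3]

theorem weylOrbit_cartanG_zero : weylOrbit cartanG (Pi.single 0 1) =
    (({![1, 0], ![-1, 1], ![2, -1], ![-2, 1], ![1, -1], ![-1, 0]} : Finset (Fin 2 → ℤ)) :
      Set (Fin 2 → ℤ)) := by
  have h0 : ![1, 0] ∈ weylOrbit cartanG (Pi.single 0 1) := by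
    rw [show (![1, 0] : Fin 2 → ℤ) = Pi.single 0 1 by decide]; exact .refl
  have h1 := simpleReflection_mem_weylOrbit h0 0 (w' := ![-1, 1]) (by decide)
  have h2 := simpleReflection_mem_weylOrbit h1 1 (w' := ![2, -1]) (by decide)
  have h3 := simpleReflection_mem_weylOrbit h2 0 (w' := ![-2, 1]) (by decide)
  have h4 := simpleReflection_mem_weylOrbit h3 1 (w' := ![1, -1]) (by decide)
  have h5 := simpleReflection_mem_weylOrbit h4 0 (w' := ![-1, 0]) (by decide)
  refine weylOrbit_eq_of_closed _ (by decide) (by decide) ?_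
  simp [h0, h1, h2, h3, h4, h5]

theorem weylOrbit_cartanG_one : weylOrbit cartanG (Pi.single 1 1) =
    (({![0, 1], ![3, -1], ![-3, 2], ![3, -2], ![-3, 1], ![0, -1]} : Finset (Fin 2 → ℤ)) :
      Set (Fin 2 → ℤ)) := by
  have h0 : ![0, 1] ∈ weylOrbit cartanG (Pi.single 1 1) := by
    rw [show (![0, 1] : Fin 2 → ℤ) = Pi.single 1 1 by decide]; exact .refl
  have h1 := simpleReflection_mem_weylOrbit h0 1 (w' := ![3, -1]) (by decide)
  have h2 := simpleReflection_mem_weylOrbit h1 0 (w' := ![-3, 2]) (by decide)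
  have h3 := simpleReflection_mem_weylOrbit h2 1 (w' := ![3, -2]) (by decide)
  have h4 := simpleReflection_mem_weylOrbit h3 0 (w' := ![-3, 1]) (by decide)
  have h5 := simpleReflection_mem_weylOrbit h4 1 (w' := ![0, -1]) (by decide)
  refine weylOrbit_eq_of_closed _ (by decide) (by decide) ?_
  simp [h0, h1, h2, h3, h4, h5]

/-! ### The folding maps -/

section Field

variable {K : Type*} [Field K]

/-! ### Orbit sums in torus coordinates -/

theorem orbitSum_cartanA_zero (t : Fin 2 → Kˣ) : orbitSum cartanA t 0 =
    (t 0 : K) + (t 1 : K) / t 0 + (t 1 : K)⁻¹ := by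
  rw [orbitSum, weylOrbit_cartanA_zero, finsum_mem_coe_finset, Finset.sum_insert (by decide),
    Finset.sum_insert (by decide), Finset.sum_singleton]
  simp [Fin.prod_univ_two]
  field_simp
  ring

theorem orbitSum_cartanA_one (t : Fin 2 → Kˣ) : orbitSum cartanA t 1 =
    (t 1 : K) + (t 0 : K) / t 1 + (t 0 : K)⁻¹ := by
  rw [orbitSum, weylOrbit_cartanA_one, finsum_mem_coe_finset, Finset.sum_insert (by decide),
    Finset.sum_insert (by decide), Finset.sum_singleton]
  simp [Fin.prod_univ_two]
  field_simp
  ring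

/-- The orbit consists of two pairs of opposite weights, with characters `u^{±1}` and `v^{±1}` for
`u = t₀`, `v = t₁/t₀`. The orbit of the other fundamental weight gives the four products
`u^{±1}v^{±1}`, whence the factored form below. -/
theorem orbitSum_cartanB_zero (t : Fin 2 → Kˣ) : orbitSum cartanB t 0 =
    ((t 0 : K) + (t 0 : K)⁻¹) + ((t 1 : K) / t 0 + (t 0 : K) / t 1) := by
  rw [orbitSum, weylOrbit_cartanB_zero, finsum_mem_coe_finset, Finset.sum_insert (by decide),
    Finset.sum_insert (by decide), Finset.sum_insert (by decide), Finset.sum_singleton]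
  simp [Fin.prod_univ_two]
  field_simp
  ring

theorem orbitSum_cartanB_one (t : Fin 2 → Kˣ) : orbitSum cartanB t 1 =
    ((t 0 : K) + (t 0 : K)⁻¹) * ((t 1 : K) / t 0 + (t 0 : K) / t 1) := by
  rw [orbitSum, weylOrbit_cartanB_one, finsum_mem_coe_finset, Finset.sum_insert (by decide),
    Finset.sum_insert (by decide), Finset.sum_insert (by decide), Finset.sum_singleton]
  simp [Fin.prod_univ_two]
  field_simp
  ring

/-- The hexagon of weights splits into two opposite triangles; the three characters of each have
product `1`, as for `A_2`. -/
theorem orbitSum_cartanG_zero (t : Fin 2 → Kˣ) : orbitSum cartanG t 0 =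
    ((t 0 : K) + (t 0 : K) / t 1 + (t 1 : K) / t 0 ^ 2) +
      ((t 0 : K)⁻¹ + (t 1 : K) / t 0 + (t 0 : K) ^ 2 / t 1) := by
  rw [orbitSum, weylOrbit_cartanG_zero, finsum_mem_coe_finset, Finset.sum_insert (by decide),
    Finset.sum_insert (by decide), Finset.sum_insert (by decide), Finset.sum_insert (by decide),
    Finset.sum_insert (by decide), Finset.sum_singleton]
  simp [Fin.prod_univ_two]
  field_simp
  ring

/-- Of the nine products of the two triangles, three are `1` and the other six form the orbit of the
second fundamental weight. -/
theorem orbitSum_cartanG_one (t : Fin 2 → Kˣ) : orbitSum cartanG t 1 =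
    ((t 0 : K) + (t 0 : K) / t 1 + (t 1 : K) / t 0 ^ 2) *
      ((t 0 : K)⁻¹ + (t 1 : K) / t 0 + (t 0 : K) ^ 2 / t 1) - 3 := by
  rw [orbitSum, weylOrbit_cartanG_one, finsum_mem_coe_finset, Finset.sum_insert (by decide),
    Finset.sum_insert (by decide), Finset.sum_insert (by decide), Finset.sum_insert (by decide),
    Finset.sum_insert (by decide), Finset.sum_singleton]
  simp [Fin.prod_univ_two]
  field_simp
  ring

end Field

section FoldingMaps

variable {K : Type*} [Field K]

theorem eval_foldA (v : Fin 2 → K) (n : ℕ) (k : Fin 2) :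
    eval v (foldA K n k) = seqA (v 0) (v 1) n k := by
  rw [foldA, map_seqA, eval_X, eval_X]

theorem eval_foldB (v : Fin 2 → K) (n : ℕ) (k : Fin 2) :
    eval v (foldB K n k) = seqB (v 0) (v 1) n k := by
  rw [foldB, map_seqB, eval_X, eval_X]

theorem eval_foldG (v : Fin 2 → K) (n : ℕ) (k : Fin 2) :
    eval v (foldG K n k) = seqG (v 0) (v 1) n k := by
  rw [foldG, map_seqG, eval_X, eval_X]

theorem powerSum₃_orbitSum_cartanA (t : Fin 2 → Kˣ) (n : ℕ) :
    powerSum₃ (orbitSum cartanA t 0) (orbitSum cartanA t 1) n = orbitSum cartanA (t ^ n) 0 := by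
  rw [powerSum₃_eq (p := (t 0 : K)) (q := (t 1 : K) / t 0) (r := (t 1 : K)⁻¹) (by field_simp)
    (orbitSum_cartanA_zero t), orbitSum_cartanA_zero]
  · simp [div_pow]
  · rw [orbitSum_cartanA_one]; field_simp; ring

theorem powerSum₃_orbitSum_cartanA_swap (t : Fin 2 → Kˣ) (n : ℕ) :
    powerSum₃ (orbitSum cartanA t 1) (orbitSum cartanA t 0) n = orbitSum cartanA (t ^ n) 1 := by
  rw [powerSum₃_eq (p := (t 1 : K)) (q := (t 0 : K) / t 1) (r := (t 0 : K)⁻¹) (by field_simp)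
    (orbitSum_cartanA_one t), orbitSum_cartanA_one]
  · simp [div_pow]
  · rw [orbitSum_cartanA_zero]; field_simp; ring

/-! ### The folding identity for the three families -/

theorem isFoldingMap_foldA [CharZero K] {i : K} (hi : i ^ 2 = -1) (n : ℕ) :
    IsFoldingMap (realCoordA i) n (foldA K n) := by
  intro t k
  have hi0 : i ≠ 0 := by rintro rfl; norm_num at hi
  have hi' : (-i) ^ 2 = -1 := by rw [neg_sq, hi]
  have hz : realCoordA i t 0 + i * realCoordA i t 1 = orbitSum cartanA t 0 := by
    simp only [realCoordA, Matrix.cons_val_zero, Matrix.cons_val_one]; field_simp; ring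
  have hw : realCoordA i t 0 - i * realCoordA i t 1 = orbitSum cartanA t 1 := by
    simp only [realCoordA, Matrix.cons_val_zero, Matrix.cons_val_one]; field_simp; ring
  have h1 := seqA_add_mul hi (realCoordA i t 0) (realCoordA i t 1) n
  have h2 := seqA_add_mul hi' (realCoordA i t 0) (realCoordA i t 1) n
  rw [neg_mul, neg_mul, ← sub_eq_add_neg, ← sub_eq_add_neg, sub_neg_eq_add, hz, hw,
    powerSum₃_orbitSum_cartanA_swap] at h2
  rw [hz, hw, powerSum₃_orbitSum_cartanA] at h1
  rw [eval_foldA]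
  fin_cases k
  · simp only [realCoordA, Fin.zero_eta, Matrix.cons_val_zero, ← h1, ← h2]
    simp only [Matrix.cons_val_zero, Matrix.cons_val_one]
    ring
  · simp only [realCoordA, Fin.mk_one, Matrix.cons_val_one, ← h1, ← h2]
    simp only [Matrix.cons_val_zero]
    field_simp
    ring

theorem isFoldingMap_foldB (n : ℕ) : IsFoldingMap (orbitSum cartanB) n (foldB K n) := by
  intro t k
  have hu : (t 0 : K) * (t 0 : K)⁻¹ = 1 := by field_simp
  have hv : (t 1 : K) / t 0 * ((t 0 : K) / t 1) = 1 := by field_simp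
  have h := seqB_eq ((t 0 : K) + (t 0 : K)⁻¹) ((t 1 : K) / t 0 + (t 0 : K) / t 1) n
  rw [dicksonVal_eq hu rfl, dicksonVal_eq hv rfl] at h
  rw [eval_foldB, orbitSum_cartanB_zero, orbitSum_cartanB_one]
  fin_cases k
  · rw [Fin.zero_eta, h.1, orbitSum_cartanB_zero]
    simp [div_pow]
  · rw [Fin.mk_one, h.2, orbitSum_cartanB_one]
    simp [div_pow]

theorem isFoldingMap_foldG (n : ℕ) : IsFoldingMap (orbitSum cartanG) n (foldG K n) := by
  have key : ∀ p q r : K, p * q * r = 1 → ∀ n,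
      seqG ((p + q + r) + (p * q + q * r + r * p))
        ((p + q + r) * (p * q + q * r + r * p) - 3) n 0 =
      (p ^ n + q ^ n + r ^ n) + ((p * q) ^ n + (q * r) ^ n + (r * p) ^ n) := by
    intro p q r h n
    rw [seqG_fst, powerSum₃_eq h rfl rfl, powerSum₃_swap_eq h rfl rfl]
  intro t k
  obtain ⟨p, hp⟩ : ∃ p : K, p = t 0 := ⟨_, rfl⟩
  obtain ⟨q, hq⟩ : ∃ q : K, q = (t 0 : K) / t 1 := ⟨_, rfl⟩
  obtain ⟨r, hr⟩ : ∃ r : K, r = (t 1 : K) / t 0 ^ 2 := ⟨_, rfl⟩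
  have h : p * q * r = 1 := by rw [hp, hq, hr]; field_simp
  have hpq : p * q = (t 0 : K) ^ 2 / t 1 := by rw [hp, hq]; field_simp
  have hqr : q * r = (t 0 : K)⁻¹ := by rw [hq, hr]; field_simp
  have hrp : r * p = (t 1 : K) / t 0 := by rw [hp, hr]; field_simp
  have h0 : orbitSum cartanG t 0 = (p + q + r) + (p * q + q * r + r * p) := by
    rw [orbitSum_cartanG_zero, hpq, hqr, hrp, hp, hq, hr]; ring
  have h1 : orbitSum cartanG t 1 = (p + q + r) * (p * q + q * r + r * p) - 3 := by
    rw [orbitSum_cartanG_one, hpq, hqr, hrp, hp, hq, hr]; ring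
  have hn : orbitSum cartanG (t ^ n) 0 =
      (p ^ n + q ^ n + r ^ n) + ((p * q) ^ n + (q * r) ^ n + (r * p) ^ n) := by
    rw [orbitSum_cartanG_zero, hpq, hqr, hrp, hp, hq, hr]
    simp [div_pow, ← pow_mul, mul_comm]
    ring
  have hn' : orbitSum cartanG (t ^ n) 1 =
      (p ^ n + q ^ n + r ^ n) * ((p * q) ^ n + (q * r) ^ n + (r * p) ^ n) - 3 := by
    rw [orbitSum_cartanG_one, hpq, hqr, hrp, hp, hq, hr]
    simp only [Pi.pow_apply, Units.val_pow_eq_pow_val]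
    ring
  rw [eval_foldG, h0, h1]
  fin_cases k
  · rw [Fin.zero_eta, hn, key p q r h]
  -- The second component is the first one for the triple `p²q, q²r, r²p`. By `e1` its first orbit
  -- sum is the old second one; by `e2` its second orbit sum is the old `X₃`.
  · have hl : p ^ 2 * q * (q ^ 2 * r) * (r ^ 2 * p) = 1 := by
      linear_combination ((p * q * r) ^ 2 + p * q * r + 1) * h
    have hpow : p ^ n * q ^ n * r ^ n = 1 := by rw [← mul_pow, ← mul_pow, h, one_pow]
    have e1 : ∀ p q r : K, p * q * r = 1 → (p + q + r) * (p * q + q * r + r * p) - 3 =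
        (p ^ 2 * q + q ^ 2 * r + r ^ 2 * p) +
        (p ^ 2 * q * (q ^ 2 * r) + q ^ 2 * r * (r ^ 2 * p) + r ^ 2 * p * (p ^ 2 * q)) :=
      fun p q r h => by linear_combination (3 - p * q ^ 2 - q * r ^ 2 - r * p ^ 2) * h
    have e2 : (p ^ 3 + q ^ 3 + r ^ 3) + ((p * q) ^ 3 + (q * r) ^ 3 + (r * p) ^ 3) =
        (p ^ 2 * q + q ^ 2 * r + r ^ 2 * p) *
        (p ^ 2 * q * (q ^ 2 * r) + q ^ 2 * r * (r ^ 2 * p) + r ^ 2 * p * (p ^ 2 * q)) - 3 := by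
      linear_combination (-3 * ((p * q * r) ^ 2 + p * q * r + 1) -
        ((p * q) ^ 3 + (q * r) ^ 3 + (r * p) ^ 3) -
        (p ^ 3 + q ^ 3 + r ^ 3) * (p * q * r + 1)) * h
    rw [Fin.mk_one, hn', seqG_snd, key p q r h, e1 p q r h, e2, key _ _ _ hl]
    linear_combination -e1 _ _ _ hpow

/-! ### Surjectivity of the invariant coordinates, uniqueness and composition -/

theorem exists_add_eq_mul_eq [IsAlgClosed K] [CharZero K] (s m : K) :
    ∃ q r : K, q + r = s ∧ q * r = m := by
  obtain ⟨d, hd⟩ := IsAlgClosed.exists_eq_mul_self (s ^ 2 - 4 * m)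
  exact ⟨(s + d) / 2, (s - d) / 2, by ring, by linear_combination hd / 4⟩

theorem exists_cubic_roots [IsAlgClosed K] [CharZero K] (z w : K) :
    ∃ p q r : K, p * q * r = 1 ∧ p + q + r = z ∧ p * q + q * r + r * p = w := by
  obtain ⟨p, hp⟩ := IsAlgClosed.exists_root
    (Polynomial.X ^ 3 - Polynomial.C z * Polynomial.X ^ 2 + Polynomial.C w * Polynomial.X - 1) (by
      have h : (Polynomial.X ^ 3 - Polynomial.C z * Polynomial.X ^ 2 +
        Polynomial.C w * Polynomial.X - 1).degree = 3 := by compute_degree!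
      rw [h]
      norm_num)
  simp only [Polynomial.IsRoot.def, Polynomial.eval_sub, Polynomial.eval_add, Polynomial.eval_pow,
    Polynomial.eval_mul, Polynomial.eval_X, Polynomial.eval_C, Polynomial.eval_one] at hp
  have hp0 : p ≠ 0 := by rintro rfl; norm_num at hp
  -- The sum and the product of the other two roots are prescribed by `z` and by `pqr = 1`; the
  -- remaining symmetric function then follows from the cubic equation for `p`.
  obtain ⟨q, r, hs, hm⟩ := exists_add_eq_mul_eq (z - p) p⁻¹
  have h1 : p * (q * r) = 1 := by rw [hm, mul_inv_cancel₀ hp0]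
  refine ⟨p, q, r, by linear_combination h1, by linear_combination hs, ?_⟩
  refine mul_left_cancel₀ hp0 ?_
  linear_combination p ^ 2 * hs + h1 - hp

theorem orbitSum_cartanA_surjective [IsAlgClosed K] [CharZero K] :
    Function.Surjective fun t : Fin 2 → Kˣ => orbitSum (K := K) cartanA t := by
  intro v
  obtain ⟨p, q, r, h, hz, hw⟩ := exists_cubic_roots (v 0) (v 1)
  have hp : p ≠ 0 := by rintro rfl; simp at h
  have hr : r ≠ 0 := by rintro rfl; simp at h
  have hq : r⁻¹ / p = q := by field_simp; linear_combination -h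
  have hw' : p / r⁻¹ = r * p := by field_simp
  have hpq : r⁻¹ = p * q := by field_simp; linear_combination -h
  have hqr : p⁻¹ = q * r := by field_simp; linear_combination -h
  -- Solves `p = t₀`, `q = t₁/t₀`, `r = t₁⁻¹`.
  refine ⟨![Units.mk0 p hp, Units.mk0 r⁻¹ (inv_ne_zero hr)], ?_⟩
  ext k
  fin_cases k
  · simp [orbitSum_cartanA_zero, hq, hz]
  · simp [orbitSum_cartanA_one]
    rw [mul_comm p r, hpq, hqr, ← hw]
    ring

theorem realCoordA_surjective [IsAlgClosed K] [CharZero K] {i : K} (hi : i ^ 2 = -1) :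
    Function.Surjective (realCoordA i) := by
  intro v
  have hi0 : i ≠ 0 := by rintro rfl; norm_num at hi
  obtain ⟨t, ht⟩ := orbitSum_cartanA_surjective ![v 0 + i * v 1, v 0 - i * v 1]
  have h0 : orbitSum cartanA t 0 = v 0 + i * v 1 := congrFun ht 0
  have h1 : orbitSum cartanA t 1 = v 0 - i * v 1 := congrFun ht 1
  refine ⟨t, ?_⟩
  ext k
  fin_cases k
  · simp only [realCoordA, h0, h1, Fin.zero_eta, Matrix.cons_val_zero]; ring
  · simp only [realCoordA, h0, h1, Fin.mk_one, Matrix.cons_val_one, Matrix.cons_val_fin_one]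
    field_simp
    ring

theorem orbitSum_cartanB_surjective [IsAlgClosed K] [CharZero K] :
    Function.Surjective fun t : Fin 2 → Kˣ => orbitSum (K := K) cartanB t := by
  intro v
  obtain ⟨a, b, hs, hm⟩ := exists_add_eq_mul_eq (v 0) (v 1)
  obtain ⟨u, u', hu, hu'⟩ := exists_add_eq_mul_eq a 1
  obtain ⟨w, w', hw, hw'⟩ := exists_add_eq_mul_eq b 1
  have hu0 : u ≠ 0 := by rintro rfl; simp at hu'
  have hw0 : w ≠ 0 := by rintro rfl; simp at hw'
  have ha : u + u⁻¹ = a := by rw [← hu, eq_inv_of_mul_eq_one_right hu']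
  have hb : w + w⁻¹ = b := by rw [← hw, eq_inv_of_mul_eq_one_right hw']
  have e1 : u * w / u = w := by field_simp
  have e2 : u / (u * w) = w⁻¹ := by field_simp
  refine ⟨![Units.mk0 u hu0, Units.mk0 (u * w) (mul_ne_zero hu0 hw0)], ?_⟩
  ext k
  fin_cases k
  · simp only [Fin.zero_eta, orbitSum_cartanB_zero, Matrix.cons_val_zero, Matrix.cons_val_one,
      Units.val_mk0, e1, e2, ha, hb, hs]
  · simp only [Fin.mk_one, orbitSum_cartanB_one, Matrix.cons_val_zero, Matrix.cons_val_one,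
      Units.val_mk0, e1, e2, ha, hb, hm]

theorem orbitSum_cartanG_surjective [IsAlgClosed K] [CharZero K] :
    Function.Surjective fun t : Fin 2 → Kˣ => orbitSum (K := K) cartanG t := by
  intro v
  obtain ⟨z, w, hs, hm⟩ := exists_add_eq_mul_eq (v 0) (v 1 + 3)
  obtain ⟨p, q, r, h, hz, hw⟩ := exists_cubic_roots z w
  have hp : p ≠ 0 := by rintro rfl; simp at h
  have hq : q ≠ 0 := by rintro rfl; simp at h
  have e1 : p / (p / q) = q := by field_simp
  have e2 : p / q / p ^ 2 = r := by field_simp; linear_combination -h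
  have e3 : p⁻¹ = q * r := by field_simp; linear_combination -h
  have e4 : p / q / p = r * p := by field_simp; linear_combination -h
  have e5 : p ^ 2 / (p / q) = p * q := by field_simp
  have ew : q * r + r * p + p * q = w := by rw [← hw]; ring
  -- Solves `p = t₀`, `q = t₀/t₁`, `r = t₁/t₀²`.
  refine ⟨![Units.mk0 p hp, Units.mk0 (p / q) (div_ne_zero hp hq)], ?_⟩
  ext k
  fin_cases k
  · simp only [Fin.zero_eta, orbitSum_cartanG_zero, Matrix.cons_val_zero, Matrix.cons_val_one,
      Units.val_mk0, e1, e2, e3, e4, e5, hz, ew, hs]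
  · simp only [Fin.mk_one, orbitSum_cartanG_one, Matrix.cons_val_zero, Matrix.cons_val_one,
      Units.val_mk0, e1, e2, e3, e4, e5, hz, ew, hm, add_sub_cancel_right]

theorem IsFoldingMap.eq [Infinite K] {Φ : (Fin 2 → Kˣ) → Fin 2 → K} (hΦ : Function.Surjective Φ)
    {n : ℕ} {F G : AffMap K} (hF : IsFoldingMap Φ n F) (hG : IsFoldingMap Φ n G) : F = G := by
  refine funext fun k => MvPolynomial.funext fun v => ?_
  obtain ⟨t, rfl⟩ := hΦ v
  rw [hF t k, hG t k]

theorem IsFoldingMap.comp {Φ : (Fin 2 → Kˣ) → Fin 2 → K} {m n : ℕ} {F G : AffMap K}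
    (hF : IsFoldingMap Φ n F) (hG : IsFoldingMap Φ m G) :
    IsFoldingMap Φ (m * n) fun k => bind₁ G (F k) := by
  intro t k
  have h : (fun j => eval (Φ t) (G j)) = Φ (t ^ m) := funext (hG t)
  rw [eval, eval₂Hom_bind₁]
  change eval (fun j => eval (Φ t) (G j)) (F k) = _
  rw [h, hF, pow_mul]

/-- Both sides send `Φ(t)` to `Φ(t^{mn})`, so uniqueness applies; no computation with the recursion
is needed. -/
theorem bind₁_foldG [IsAlgClosed K] [CharZero K] (m n : ℕ) (k : Fin 2) :
    bind₁ (foldG K m) (foldG K n k) = foldG K (m * n) k :=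
  congrFun (IsFoldingMap.eq orbitSum_cartanG_surjective
    ((isFoldingMap_foldG n).comp (isFoldingMap_foldG m)) (isFoldingMap_foldG (m * n))) k

end FoldingMaps

section Degrees

variable {K : Type*} [Field K]

theorem totalDegree_X_pow_le (i : Fin 2) (n : ℕ) :
    (X i ^ n : MvPolynomial (Fin 2) K).totalDegree ≤ n := (totalDegree_X_pow i n).le

theorem totalDegree_X_le (i : Fin 2) : (X i : MvPolynomial (Fin 2) K).totalDegree ≤ 1 :=
  (totalDegree_X i).le

theorem totalDegree_ofNat_le {σ : Type*} (d n : ℕ) [n.AtLeastTwo] :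
    (OfNat.ofNat n : MvPolynomial σ K).totalDegree ≤ d :=
  (totalDegree_ofNat n).le.trans (Nat.zero_le d)

/-! ### Leading forms of `A_n` -/

/-- Only the term `z * powerSum₃ z w (n + 2)` reaches the top degree. The degree bound is stated
separately because at index `0` the value is `3`, not `a ^ 0`. -/
theorem hasLead_powerSum₃ {v : Fin 2 → K} {z w : MvPolynomial (Fin 2) K} {a b : K}
    (hz : HasLead v 1 z a) (hw : HasLead v 1 w b) : ∀ n,
      (powerSum₃ z w n).totalDegree ≤ n ∧
        HasLead v (n + 1) (powerSum₃ z w (n + 1)) (a ^ (n + 1))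
  | 0 => ⟨(totalDegree_ofNat 3).le, by simpa [powerSum₃] using hz⟩
  | 1 => ⟨hz.1, by
      have h := (hz.pow 2).sub (HasLead.of_lt (p := 2 * w) (d := 2) ?_)
      · simpa [powerSum₃] using h
      · exact (totalDegree_mul_le (totalDegree_ofNat_le 0 2) hw.1 le_rfl).trans_lt (by norm_num)⟩
  | n + 2 => by
    have h0 := (hasLead_powerSum₃ hz hw n).1
    have h1 := (hasLead_powerSum₃ hz hw n).2
    have h2 := (hasLead_powerSum₃ hz hw (n + 1)).2
    refine ⟨h2.1, ?_⟩
    have h := ((hz.mul h2).sub (HasLead.of_lt (d := 1 + (n + 1 + 1))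
      (p := w * powerSum₃ z w (n + 1)) ?_)).add (HasLead.of_lt (p := powerSum₃ z w n) ?_)
    · rw [sub_zero, add_zero, ← pow_succ', Nat.add_comm 1] at h
      exact h
    · exact (totalDegree_mul_le hw.1 h1.1 le_rfl).trans_lt (by omega)
    · exact h0.trans_lt (by omega)

theorem foldA_fst [CharZero K] {i : K} (hi : i ^ 2 = -1) (n : ℕ) :
    foldA K n 0 = C (1 / 2) * (powerSum₃ (X 0 + C i * X 1) (X 0 - C i * X 1) n +
      powerSum₃ (X 0 - C i * X 1) (X 0 + C i * X 1) n) := by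
  have h1 := seqA_add_mul (show (C i : MvPolynomial (Fin 2) K) ^ 2 = -1 by
    rw [← map_pow, hi, map_neg, map_one]) (X 0) (X 1) n
  have h2 := seqA_add_mul (show (-C i : MvPolynomial (Fin 2) K) ^ 2 = -1 by
    rw [neg_sq, ← map_pow, hi, map_neg, map_one]) (X 0) (X 1) n
  rw [neg_mul, neg_mul, ← sub_eq_add_neg, ← sub_eq_add_neg, sub_neg_eq_add] at h2
  have h3 : (C (1 / 2) : MvPolynomial (Fin 2) K) * 2 = 1 := by
    rw [← map_ofNat C 2, ← map_mul, ← map_one C]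
    norm_num
  rw [← h1, ← h2, foldA]
  linear_combination -seqA (X 0 : MvPolynomial (Fin 2) K) (X 1) n 0 * h3

theorem foldA_snd [CharZero K] {i : K} (hi : i ^ 2 = -1) (n : ℕ) :
    foldA K n 1 = C (-i / 2) * (powerSum₃ (X 0 + C i * X 1) (X 0 - C i * X 1) n -
      powerSum₃ (X 0 - C i * X 1) (X 0 + C i * X 1) n) := by
  have h1 := seqA_add_mul (show (C i : MvPolynomial (Fin 2) K) ^ 2 = -1 by
    rw [← map_pow, hi, map_neg, map_one]) (X 0) (X 1) n
  have h2 := seqA_add_mul (show (-C i : MvPolynomial (Fin 2) K) ^ 2 = -1 by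
    rw [neg_sq, ← map_pow, hi, map_neg, map_one]) (X 0) (X 1) n
  rw [neg_mul, neg_mul, ← sub_eq_add_neg, ← sub_eq_add_neg, sub_neg_eq_add] at h2
  have h3 : (C (-i / 2) : MvPolynomial (Fin 2) K) * (2 * C i) = 1 := by
    rw [← map_ofNat C 2, ← map_mul, ← map_mul, ← map_one C]
    congr 1
    linear_combination -hi
  rw [← h1, ← h2, foldA]
  linear_combination -seqA (X 0 : MvPolynomial (Fin 2) K) (X 1) n 1 * h3

theorem hasLead_foldA [CharZero K] {i : K} (hi : i ^ 2 = -1) (v : Fin 2 → K) (n : ℕ) :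
    HasLead v (n + 1) (foldA K (n + 1) 0)
      (1 / 2 * ((v 0 + i * v 1) ^ (n + 1) + (v 0 - i * v 1) ^ (n + 1))) ∧
    HasLead v (n + 1) (foldA K (n + 1) 1)
      (-i / 2 * ((v 0 + i * v 1) ^ (n + 1) - (v 0 - i * v 1) ^ (n + 1))) := by
  have hz : HasLead v 1 (X 0 + C i * X 1) (v 0 + i * v 1) :=
    (HasLead.X 0).add ((HasLead.X 1).const_mul i)
  have hw : HasLead v 1 (X 0 - C i * X 1) (v 0 - i * v 1) :=
    (HasLead.X 0).sub ((HasLead.X 1).const_mul i)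
  rw [foldA_fst hi, foldA_snd hi]
  exact ⟨((hasLead_powerSum₃ hz hw n).2.add (hasLead_powerSum₃ hw hz n).2).const_mul _,
    ((hasLead_powerSum₃ hz hw n).2.sub (hasLead_powerSum₃ hw hz n).2).const_mul _⟩

theorem exists_sq_eq_neg_one [IsAlgClosed K] : ∃ i : K, i ^ 2 = -1 := by
  obtain ⟨i, hi⟩ := IsAlgClosed.exists_eq_mul_self (-1 : K)
  exact ⟨i, by rw [sq, hi]⟩

theorem max_totalDegree_foldA [IsAlgClosed K] [CharZero K] (n : ℕ) :
    max (foldA K n 0).totalDegree (foldA K n 1).totalDegree = n := by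
  obtain ⟨i, hi⟩ := exists_sq_eq_neg_one (K := K)
  cases n with
  | zero => simpa [foldA, seqA] using totalDegree_ofNat 3
  | succ n =>
    obtain ⟨h0, h1⟩ := hasLead_foldA hi ![1, 0] n
    rw [h0.totalDegree_eq (by simp), max_eq_left h1.1]

theorem isMorphism_foldA [IsAlgClosed K] [CharZero K] (n : ℕ) :
    (homogenization (foldA K n)).IsMorphism := by
  obtain ⟨i, hi⟩ := exists_sq_eq_neg_one (K := K)
  have hi0 : i ≠ 0 := by rintro rfl; norm_num at hi
  cases n with
  | zero => exact isMorphism_homogenization_of_eq_zero (max_totalDegree_foldA 0)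
  | succ n =>
    refine isMorphism_homogenization (max_totalDegree_foldA _) n.succ_pos fun v hv => ?_
    obtain ⟨h0, h1⟩ := hasLead_foldA hi v n
    have e0 := h0.2.symm.trans (hv 0)
    have e1 := h1.2.symm.trans (hv 1)
    -- The two leading forms are the real and imaginary parts of the power, formally; `e0 + i * e1`
    -- and `e0 - i * e1` recover the power and its conjugate.
    have hz : (v 0 + i * v 1) ^ (n + 1) = 0 := by
      linear_combination e0 + i * e1 + (1 / 2) * ((v 0 + i * v 1) ^ (n + 1) -
        (v 0 - i * v 1) ^ (n + 1)) * hi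
    have hw : (v 0 - i * v 1) ^ (n + 1) = 0 := by
      linear_combination e0 - i * e1 - (1 / 2) * ((v 0 + i * v 1) ^ (n + 1) -
        (v 0 - i * v 1) ^ (n + 1)) * hi
    have hz' := eq_zero_of_pow_eq_zero hz
    have hw' := eq_zero_of_pow_eq_zero hw
    have h1 : i * v 1 = 0 := by linear_combination (hz' - hw') / 2
    ext k
    fin_cases k
    · exact show v 0 = 0 by linear_combination (hz' + hw') / 2
    · exact (mul_eq_zero.mp h1).resolve_left hi0

end Degrees

section DegreesB

variable {K : Type*} [Field K]

/-! ### Leading forms of `B_n` -/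

theorem totalDegree_neg_le {σ : Type*} {p : MvPolynomial σ K} {d : ℕ} (h : p.totalDegree ≤ d) :
    (-p).totalDegree ≤ d := (totalDegree_neg p).le.trans h

theorem totalDegree_mul_le_add {σ : Type*} {p q : MvPolynomial σ K} {a b : ℕ}
    (hp : p.totalDegree ≤ a) (hq : q.totalDegree ≤ b) : (p * q).totalDegree ≤ a + b :=
  totalDegree_mul_le hp hq le_rfl

theorem totalDegree_two_add_X_le : (2 + X 1 : MvPolynomial (Fin 2) K).totalDegree ≤ 1 :=
  totalDegree_add_le (totalDegree_ofNat_le _ _) (totalDegree_X_le _)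

theorem totalDegree_sq_sub_le :
    (X 0 ^ 2 - 2 * X 1 - 2 : MvPolynomial (Fin 2) K).totalDegree ≤ 2 := by
  refine totalDegree_sub_le (totalDegree_sub_le (totalDegree_X_pow_le _ _)
    (totalDegree_mul_le (totalDegree_ofNat_le 0 _) (totalDegree_X_le _) ?_))
    (totalDegree_ofNat_le _ _)
  norm_num

theorem foldB_add_four_fst (n : ℕ) : foldB K (n + 4) 0 =
    X 0 * (foldB K (n + 3) 0 + foldB K (n + 1) 0) - (2 + X 1) * foldB K (n + 2) 0 -
      foldB K n 0 := rfl

theorem foldB_add_four_snd (n : ℕ) : foldB K (n + 4) 1 =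
    X 1 * (foldB K (n + 3) 1 + foldB K (n + 1) 1) -
      (X 0 ^ 2 - 2 * X 1 - 2) * foldB K (n + 2) 1 - foldB K n 1 := rfl

theorem totalDegree_foldB_two_le (k : Fin 2) : (foldB K 2 k).totalDegree ≤ 2 := by
  fin_cases k
  · change (X 0 ^ 2 - 2 * X 1 - 4 : MvPolynomial (Fin 2) K).totalDegree ≤ 2
    -- The search descends through sums and products. The bounds of factors start as metavariables
    -- fixed at the leaves, where a numeral takes the bound `0`; `norm_num` then checks the sums of
    -- the bounds.
    repeat' first
      | with_reducible exact totalDegree_X_le _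
      | with_reducible exact totalDegree_X_pow_le _ _
      | with_reducible exact totalDegree_ofNat_le 0 _
      | with_reducible exact totalDegree_ofNat_le _ _
      | with_reducible refine totalDegree_sub_le ?_ ?_
      | with_reducible refine totalDegree_add_le ?_ ?_
      | with_reducible apply totalDegree_mul_le_add
      | with_reducible apply totalDegree_mul_le
      | with_reducible exact (totalDegree_X_le _).trans (by norm_num)
      | with_reducible exact (totalDegree_X_pow_le _ _).trans (by norm_num)
      | (show (_ : ℕ) + _ ≤ _; norm_num)
  · change (X 1 ^ 2 - 2 * X 0 ^ 2 + 4 * X 1 + 4 : MvPolynomial (Fin 2) K).totalDegree ≤ 2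
    repeat' first
      | with_reducible exact totalDegree_X_le _
      | with_reducible exact totalDegree_X_pow_le _ _
      | with_reducible exact totalDegree_ofNat_le 0 _
      | with_reducible exact totalDegree_ofNat_le _ _
      | with_reducible refine totalDegree_sub_le ?_ ?_
      | with_reducible refine totalDegree_add_le ?_ ?_
      | with_reducible apply totalDegree_mul_le_add
      | with_reducible apply totalDegree_mul_le
      | with_reducible exact (totalDegree_X_le _).trans (by norm_num)
      | with_reducible exact (totalDegree_X_pow_le _ _).trans (by norm_num)
      | (show (_ : ℕ) + _ ≤ _; norm_num)

theorem totalDegree_foldB_three_le (k : Fin 2) : (foldB K 3 k).totalDegree ≤ 3 := by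
  fin_cases k
  · change (X 0 ^ 3 - 3 * X 0 * X 1 - 3 * X 0 : MvPolynomial (Fin 2) K).totalDegree ≤ 3
    repeat' first
      | with_reducible exact totalDegree_X_le _
      | with_reducible exact totalDegree_X_pow_le _ _
      | with_reducible exact totalDegree_ofNat_le 0 _
      | with_reducible exact totalDegree_ofNat_le _ _
      | with_reducible refine totalDegree_sub_le ?_ ?_
      | with_reducible refine totalDegree_add_le ?_ ?_
      | with_reducible apply totalDegree_mul_le_add
      | with_reducible apply totalDegree_mul_le
      | with_reducible exact (totalDegree_X_le _).trans (by norm_num)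
      | with_reducible exact (totalDegree_X_pow_le _ _).trans (by norm_num)
      | (show (_ : ℕ) + _ ≤ _; norm_num)
  · change (X 1 ^ 3 - 3 * X 0 ^ 2 * X 1 + 6 * X 1 ^ 2 + 9 * X 1 :
      MvPolynomial (Fin 2) K).totalDegree ≤ 3
    repeat' first
      | with_reducible exact totalDegree_X_le _
      | with_reducible exact totalDegree_X_pow_le _ _
      | with_reducible exact totalDegree_ofNat_le 0 _
      | with_reducible exact totalDegree_ofNat_le _ _
      | with_reducible refine totalDegree_sub_le ?_ ?_
      | with_reducible refine totalDegree_add_le ?_ ?_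
      | with_reducible apply totalDegree_mul_le_add
      | with_reducible apply totalDegree_mul_le
      | with_reducible exact (totalDegree_X_le _).trans (by norm_num)
      | with_reducible exact (totalDegree_X_pow_le _ _).trans (by norm_num)
      | (show (_ : ℕ) + _ ≤ _; norm_num)

theorem totalDegree_foldB_le : ∀ n k, (foldB K n k).totalDegree ≤ n
  | 0, k => by fin_cases k <;> exact totalDegree_ofNat_le 0 4
  | 1, k => by fin_cases k <;> exact totalDegree_X_le _
  | 2, k => totalDegree_foldB_two_le k
  | 3, k => totalDegree_foldB_three_le k
  | n + 4, k => by
    have h0 := totalDegree_foldB_le n k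
    have h1 := totalDegree_foldB_le (n + 1) k
    have h2 := totalDegree_foldB_le (n + 2) k
    have h3 := totalDegree_foldB_le (n + 3) k
    have h13 := totalDegree_add_le h3 (h1.trans (show n + 1 ≤ n + 3 by omega))
    fin_cases k
    · rw [Fin.zero_eta, foldB_add_four_fst]
      exact totalDegree_sub_le (totalDegree_sub_le
        (totalDegree_mul_le (totalDegree_X_le _) h13 (by omega))
        (totalDegree_mul_le totalDegree_two_add_X_le h2 (by omega))) (h0.trans (by omega))
    · rw [Fin.mk_one, foldB_add_four_snd]
      exact totalDegree_sub_le (totalDegree_sub_le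
        (totalDegree_mul_le (totalDegree_X_le _) h13 (by omega))
        (totalDegree_mul_le totalDegree_sq_sub_le h2 (by omega))) (h0.trans (by omega))

theorem HasLead.add_of_lt {v : Fin 2 → K} {d : ℕ} {p q r : MvPolynomial (Fin 2) K} {a : K}
    (hp : HasLead v d p a) (hq : q.totalDegree < d) (h : r = p + q) : HasLead v d r a := by
  rw [h, ← add_zero a]
  exact hp.add (HasLead.of_lt hq)

/-- Only `x X_{n+3}` reaches degree `n + 4`; the term `(2 + y) X_{n+2}` falls one short. -/
theorem hasLead_foldB_fst (v : Fin 2 → K) : ∀ n,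
    HasLead v (n + 1) (foldB K (n + 1) 0) (v 0 ^ (n + 1))
  | 0 => by rw [zero_add, pow_one]; exact HasLead.X 0
  | 1 => by
    have h := (HasLead.X (v := v) 0).pow 2
    refine h.add_of_lt (q := -(2 * X 1) - 4) (Nat.lt_of_le_of_lt (m := 1) ?_ (by norm_num)) ?_
    · exact totalDegree_sub_le (totalDegree_neg_le (totalDegree_mul_le (totalDegree_ofNat_le 0 _)
        (totalDegree_X_le _) le_rfl)) (totalDegree_ofNat_le _ _)
    · simp [foldB, seqB]; ring
  | 2 => by
    have h := (HasLead.X (v := v) 0).pow 3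
    refine h.add_of_lt (q := -(X 0 * (3 * X 1 + 3))) (Nat.lt_of_le_of_lt (m := 2) ?_
      (by norm_num)) ?_
    · exact totalDegree_neg_le (totalDegree_mul_le (totalDegree_X_le _)
        (totalDegree_add_le (totalDegree_mul_le (totalDegree_ofNat_le 0 _)
          (totalDegree_X_le _) le_rfl) (totalDegree_ofNat_le _ _)) le_rfl)
    · simp [foldB, seqB]; ring
  | n + 3 => by
    have h := (HasLead.X (v := v) 0).mul (hasLead_foldB_fst v (n + 2))
    rw [← pow_succ', Nat.add_comm 1] at h
    refine h.add_of_lt (q := X 0 * foldB K (n + 1) 0 - (2 + X 1) * foldB K (n + 2) 0 -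
      foldB K n 0) (Nat.lt_of_le_of_lt (m := n + 3) ?_ (by omega)) ?_
    · exact totalDegree_sub_le (totalDegree_sub_le
        (totalDegree_mul_le (totalDegree_X_le _) (totalDegree_foldB_le _ _) (by omega))
        (totalDegree_mul_le totalDegree_two_add_X_le (totalDegree_foldB_le _ _) (by omega)))
        ((totalDegree_foldB_le _ _).trans (by omega))
    · simp only [foldB, seqB, Matrix.cons_val_zero]; ring

/-- The first component already forces `x = 0` at a common zero, so the leading form is needed only
there. This removes the competing term `x² Y_{n+2}`. -/
theorem hasLead_foldB_snd {v : Fin 2 → K} (hv : v 0 = 0) : ∀ n,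
    HasLead v (n + 1) (foldB K (n + 1) 1) (v 1 ^ (n + 1))
  | 0 => by rw [zero_add, pow_one]; exact HasLead.X 1
  | 1 => by
    have h := ((HasLead.X (v := v) 1).pow 2).sub (((HasLead.X (v := v) 0).pow 2).const_mul 2)
    rw [hv, zero_pow two_ne_zero, mul_zero, sub_zero] at h
    refine h.add_of_lt (q := 4 * X 1 + 4) (Nat.lt_of_le_of_lt (m := 1) ?_ (by norm_num)) ?_
    · exact totalDegree_add_le (totalDegree_mul_le (totalDegree_ofNat_le 0 _)
        (totalDegree_X_le _) le_rfl) (totalDegree_ofNat_le _ _)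
    · simp [foldB, seqB, map_ofNat]; ring
  | 2 => by
    have h := ((HasLead.X (v := v) 1).pow 3).sub
      ((((HasLead.X (v := v) 0).pow 2).mul (HasLead.X 1)).const_mul 3)
    rw [hv, zero_pow two_ne_zero, zero_mul, mul_zero, sub_zero] at h
    refine h.add_of_lt (q := X 1 * (6 * X 1 + 9)) (Nat.lt_of_le_of_lt (m := 2) ?_
      (by norm_num)) ?_
    · exact totalDegree_mul_le (totalDegree_X_le _)
        (totalDegree_add_le (totalDegree_mul_le (totalDegree_ofNat_le 0 _)
          (totalDegree_X_le _) le_rfl) (totalDegree_ofNat_le _ _)) le_rfl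
    · simp [foldB, seqB, map_ofNat]; ring
  | n + 3 => by
    have h := (HasLead.X (v := v) 1).mul (hasLead_foldB_snd hv (n + 2))
    -- The leading value of `Y_{n+2}` is left unspecified, since the factor `x²` vanishes at `v`.
    have h' := ((HasLead.X (v := v) 0).pow 2).mul
      (show HasLead v (n + 2) (foldB K (n + 2) 1) _ from ⟨totalDegree_foldB_le _ _, rfl⟩)
    rw [hv, zero_pow two_ne_zero, zero_mul, show 2 * 1 + (n + 2) = n + 3 + 1 by omega] at h'
    rw [← pow_succ', Nat.add_comm 1] at h
    have h'' := h.sub h'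
    rw [sub_zero] at h''
    refine h''.add_of_lt (q := X 1 * foldB K (n + 1) 1 + 2 * ((X 1 + 1) * foldB K (n + 2) 1) -
      foldB K n 1) (Nat.lt_of_le_of_lt (m := n + 3) ?_ (by omega)) ?_
    · exact totalDegree_sub_le (totalDegree_add_le
        (totalDegree_mul_le (totalDegree_X_le _) (totalDegree_foldB_le _ _) (by omega))
        (totalDegree_mul_le (totalDegree_ofNat_le 0 2) (totalDegree_mul_le (totalDegree_add_le
          (totalDegree_X_le _) (totalDegree_one.le.trans zero_le_one))
          (totalDegree_foldB_le _ _) le_rfl) (by omega)))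
        ((totalDegree_foldB_le _ _).trans (by omega))
    · simp only [foldB, seqB, Matrix.cons_val_one, Matrix.cons_val_fin_one]; ring

theorem max_totalDegree_foldB (n : ℕ) :
    max (foldB K n 0).totalDegree (foldB K n 1).totalDegree = n := by
  cases n with
  | zero => simpa [foldB, seqB] using totalDegree_ofNat 4
  | succ n =>
    rw [(hasLead_foldB_fst ![1, 0] n).totalDegree_eq (by simp),
      max_eq_left (totalDegree_foldB_le _ _)]

theorem isMorphism_foldB [Infinite K] (n : ℕ) : (homogenization (foldB K n)).IsMorphism := by
  cases n with
  | zero => exact isMorphism_homogenization_of_eq_zero (max_totalDegree_foldB 0)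
  | succ n =>
    refine isMorphism_homogenization (max_totalDegree_foldB _) n.succ_pos fun v hv => ?_
    have h0 : v 0 = 0 := eq_zero_of_pow_eq_zero ((hasLead_foldB_fst v n).2.symm.trans (hv 0))
    have h1 : v 1 = 0 := eq_zero_of_pow_eq_zero ((hasLead_foldB_snd h0 n).2.symm.trans (hv 1))
    ext k
    fin_cases k
    · exact h0
    · exact h1

end DegreesB

section DegreesG

variable {K : Type*} [Field K]

/-! ### Leading forms of `G_n` -/

theorem totalDegree_foldG_two_fst_le : (foldG K 2 0).totalDegree ≤ 2 := by
  change (X 0 ^ 2 - 2 * X 0 - 2 * X 1 - 6 :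
    MvPolynomial (Fin 2) K).totalDegree ≤ 2
  repeat' first
    | with_reducible exact totalDegree_X_le _
    | with_reducible exact totalDegree_X_pow_le _ _
    | with_reducible exact totalDegree_ofNat_le 0 _
    | with_reducible exact totalDegree_ofNat_le _ _
    | with_reducible refine totalDegree_sub_le ?_ ?_
    | with_reducible refine totalDegree_add_le ?_ ?_
    | with_reducible apply totalDegree_mul_le_add
    | with_reducible apply totalDegree_mul_le
    | with_reducible exact (totalDegree_X_le _).trans (by norm_num)
    | with_reducible exact (totalDegree_X_pow_le _ _).trans (by norm_num)
    | (with_reducible show (_ : ℕ) + _ ≤ _; norm_num)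

theorem totalDegree_foldG_three_fst_le : (foldG K 3 0).totalDegree ≤ 3 := by
  change (X 0 ^ 3 - 3 * X 0 * X 1 - 9 * X 0 - 6 * X 1 - 12 :
    MvPolynomial (Fin 2) K).totalDegree ≤ 3
  repeat' first
    | with_reducible exact totalDegree_X_le _
    | with_reducible exact totalDegree_X_pow_le _ _
    | with_reducible exact totalDegree_ofNat_le 0 _
    | with_reducible exact totalDegree_ofNat_le _ _
    | with_reducible refine totalDegree_sub_le ?_ ?_
    | with_reducible refine totalDegree_add_le ?_ ?_
    | with_reducible apply totalDegree_mul_le_add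
    | with_reducible apply totalDegree_mul_le
    | with_reducible exact (totalDegree_X_le _).trans (by norm_num)
    | with_reducible exact (totalDegree_X_pow_le _ _).trans (by norm_num)
    | (with_reducible show (_ : ℕ) + _ ≤ _; norm_num)

theorem totalDegree_foldG_four_fst_le : (foldG K 4 0).totalDegree ≤ 4 := by
  change (X 0 ^ 4 - 4 * X 0 ^ 2 * X 1 - 10 * X 0 ^ 2 - 4 * X 0 * X 1 + 2 * X 1 ^ 2
             - 8 * X 0 + 8 * X 1 + 6 :
    MvPolynomial (Fin 2) K).totalDegree ≤ 4
  repeat' first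
    | with_reducible exact totalDegree_X_le _
    | with_reducible exact totalDegree_X_pow_le _ _
    | with_reducible exact totalDegree_ofNat_le 0 _
    | with_reducible exact totalDegree_ofNat_le _ _
    | with_reducible refine totalDegree_sub_le ?_ ?_
    | with_reducible refine totalDegree_add_le ?_ ?_
    | with_reducible apply totalDegree_mul_le_add
    | with_reducible apply totalDegree_mul_le
    | with_reducible exact (totalDegree_X_le _).trans (by norm_num)
    | with_reducible exact (totalDegree_X_pow_le _ _).trans (by norm_num)
    | (with_reducible show (_ : ℕ) + _ ≤ _; norm_num)

theorem totalDegree_foldG_five_fst_le : (foldG K 5 0).totalDegree ≤ 5 := by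
  change (X 0 ^ 5 - 5 * X 0 ^ 3 * X 1 - 15 * X 0 ^ 3 - 5 * X 0 ^ 2 * X 1
             + 5 * X 0 * X 1 ^ 2 - 10 * X 0 ^ 2 + 35 * X 0 * X 1 + 10 * X 1 ^ 2
             + 55 * X 0 + 50 * X 1 + 60 :
    MvPolynomial (Fin 2) K).totalDegree ≤ 5
  repeat' first
    | with_reducible exact totalDegree_X_le _
    | with_reducible exact totalDegree_X_pow_le _ _
    | with_reducible exact totalDegree_ofNat_le 0 _
    | with_reducible exact totalDegree_ofNat_le _ _
    | with_reducible refine totalDegree_sub_le ?_ ?_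
    | with_reducible refine totalDegree_add_le ?_ ?_
    | with_reducible apply totalDegree_mul_le_add
    | with_reducible apply totalDegree_mul_le
    | with_reducible exact (totalDegree_X_le _).trans (by norm_num)
    | with_reducible exact (totalDegree_X_pow_le _ _).trans (by norm_num)
    | (with_reducible show (_ : ℕ) + _ ≤ _; norm_num)

theorem totalDegree_foldG_two_snd_le : (foldG K 2 1).totalDegree ≤ 3 := by
  change (-2 * X 0 ^ 3 + 6 * X 0 * X 1 + X 1 ^ 2 + 18 * X 0 + 10 * X 1 + 18 :
    MvPolynomial (Fin 2) K).totalDegree ≤ 3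
  repeat' first
    | with_reducible exact totalDegree_X_le _
    | with_reducible exact totalDegree_X_pow_le _ _
    | with_reducible exact totalDegree_ofNat_le 0 _
    | with_reducible exact totalDegree_ofNat_le _ _
    | with_reducible refine totalDegree_sub_le ?_ ?_
    | with_reducible refine totalDegree_add_le ?_ ?_
    | with_reducible apply totalDegree_mul_le_add
    | with_reducible apply totalDegree_mul_le
    | with_reducible exact (totalDegree_X_le _).trans (by norm_num)
    | with_reducible exact (totalDegree_X_pow_le _ _).trans (by norm_num)
    | (with_reducible show (_ : ℕ) + _ ≤ _; norm_num)
    | exact totalDegree_neg_le (totalDegree_ofNat_le 0 _)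

theorem totalDegree_foldG_three_snd_le : (foldG K 3 1).totalDegree ≤ 4 := by
  change (-3 * X 0 ^ 3 * X 1 - 6 * X 0 ^ 3 + 9 * X 0 * X 1 ^ 2 + X 1 ^ 3 + 45 * X 0 * X 1
             + 18 * X 1 ^ 2 + 54 * X 0 + 63 * X 1 + 60 :
    MvPolynomial (Fin 2) K).totalDegree ≤ 4
  repeat' first
    | with_reducible exact totalDegree_X_le _
    | with_reducible exact totalDegree_X_pow_le _ _
    | with_reducible exact totalDegree_ofNat_le 0 _
    | with_reducible exact totalDegree_ofNat_le _ _
    | with_reducible refine totalDegree_sub_le ?_ ?_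
    | with_reducible refine totalDegree_add_le ?_ ?_
    | with_reducible apply totalDegree_mul_le_add
    | with_reducible apply totalDegree_mul_le
    | with_reducible exact (totalDegree_X_le _).trans (by norm_num)
    | with_reducible exact (totalDegree_X_pow_le _ _).trans (by norm_num)
    | (with_reducible show (_ : ℕ) + _ ≤ _; norm_num)
    | exact totalDegree_neg_le (totalDegree_ofNat_le 0 _)

theorem totalDegree_coeffTwo_fst_le :
    (X 0 + X 1 + 3 : MvPolynomial (Fin 2) K).totalDegree ≤ 1 :=
  totalDegree_add_le (totalDegree_add_le (totalDegree_X_le _) (totalDegree_X_le _))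
    (totalDegree_ofNat_le _ _)

theorem totalDegree_coeffThree_fst_le :
    (X 0 ^ 2 - 2 * X 1 - 4 :
      MvPolynomial (Fin 2) K).totalDegree ≤ 2 := by
  repeat' first
    | with_reducible exact totalDegree_X_le _
    | with_reducible exact totalDegree_X_pow_le _ _
    | with_reducible exact totalDegree_ofNat_le 0 _
    | with_reducible exact totalDegree_ofNat_le _ _
    | with_reducible refine totalDegree_sub_le ?_ ?_
    | with_reducible refine totalDegree_add_le ?_ ?_
    | with_reducible apply totalDegree_mul_le_add
    | with_reducible apply totalDegree_mul_le
    | with_reducible exact (totalDegree_X_le _).trans (by norm_num)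
    | with_reducible exact (totalDegree_X_pow_le _ _).trans (by norm_num)
    | (with_reducible show (_ : ℕ) + _ ≤ _; norm_num)

theorem totalDegree_coeffTwo_snd_le :
    (X 0 ^ 3 - 3 * X 0 * X 1 - 9 * X 0 - 5 * X 1 - 9 :
      MvPolynomial (Fin 2) K).totalDegree ≤ 3 := by
  repeat' first
    | with_reducible exact totalDegree_X_le _
    | with_reducible exact totalDegree_X_pow_le _ _
    | with_reducible exact totalDegree_ofNat_le 0 _
    | with_reducible exact totalDegree_ofNat_le _ _
    | with_reducible refine totalDegree_sub_le ?_ ?_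
    | with_reducible refine totalDegree_add_le ?_ ?_
    | with_reducible apply totalDegree_mul_le_add
    | with_reducible apply totalDegree_mul_le
    | with_reducible exact (totalDegree_X_le _).trans (by norm_num)
    | with_reducible exact (totalDegree_X_pow_le _ _).trans (by norm_num)
    | (with_reducible show (_ : ℕ) + _ ≤ _; norm_num)

/-- This is `x³` minus the coefficient bounded in `totalDegree_coeffTwo_snd_le`. -/
theorem totalDegree_coeffTwo_snd_tail_le :
    (3 * X 0 * X 1 + 9 * X 0 + 5 * X 1 + 9 :
      MvPolynomial (Fin 2) K).totalDegree ≤ 2 := by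
  repeat' first
    | with_reducible exact totalDegree_X_le _
    | with_reducible exact totalDegree_X_pow_le _ _
    | with_reducible exact totalDegree_ofNat_le 0 _
    | with_reducible exact totalDegree_ofNat_le _ _
    | with_reducible refine totalDegree_sub_le ?_ ?_
    | with_reducible refine totalDegree_add_le ?_ ?_
    | with_reducible apply totalDegree_mul_le_add
    | with_reducible apply totalDegree_mul_le
    | with_reducible exact (totalDegree_X_le _).trans (by norm_num)
    | with_reducible exact (totalDegree_X_pow_le _ _).trans (by norm_num)
    | (with_reducible show (_ : ℕ) + _ ≤ _; norm_num)

theorem totalDegree_coeffThree_snd_le :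
    (X 1 ^ 2 - 2 * X 0 ^ 3 + 6 * X 0 * X 1 + 18 * X 0 + 12 * X 1 + 20 :
      MvPolynomial (Fin 2) K).totalDegree ≤ 3 := by
  repeat' first
    | with_reducible exact totalDegree_X_le _
    | with_reducible exact totalDegree_X_pow_le _ _
    | with_reducible exact totalDegree_ofNat_le 0 _
    | with_reducible exact totalDegree_ofNat_le _ _
    | with_reducible refine totalDegree_sub_le ?_ ?_
    | with_reducible refine totalDegree_add_le ?_ ?_
    | with_reducible apply totalDegree_mul_le_add
    | with_reducible apply totalDegree_mul_le
    | with_reducible exact (totalDegree_X_le _).trans (by norm_num)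
    | with_reducible exact (totalDegree_X_pow_le _ _).trans (by norm_num)
    | (with_reducible show (_ : ℕ) + _ ≤ _; norm_num)

/-- This polynomial is `Y₃ - yY₂ + x³Y₁`, the remainder for `k = 0` in `exists_foldG_snd_eq`. -/
theorem totalDegree_remainder_three_le :
    (-6 * X 0 ^ 3 + 3 * X 0 * X 1 ^ 2 + 27 * X 0 * X 1 + 8 * X 1 ^ 2 + 54 * X 0 + 45 * X 1 + 60 :
      MvPolynomial (Fin 2) K).totalDegree ≤ 3 := by
  repeat' first
    | with_reducible exact totalDegree_X_le _
    | with_reducible exact totalDegree_X_pow_le _ _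
    | with_reducible exact totalDegree_ofNat_le 0 _
    | with_reducible exact totalDegree_ofNat_le _ _
    | with_reducible refine totalDegree_sub_le ?_ ?_
    | with_reducible refine totalDegree_add_le ?_ ?_
    | with_reducible apply totalDegree_mul_le_add
    | with_reducible apply totalDegree_mul_le
    | with_reducible exact (totalDegree_X_le _).trans (by norm_num)
    | with_reducible exact (totalDegree_X_pow_le _ _).trans (by norm_num)
    | (with_reducible show (_ : ℕ) + _ ≤ _; norm_num)
    | exact totalDegree_neg_le (totalDegree_ofNat_le 0 _)

/-- This polynomial is `Y₂ + 2x³`. -/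
theorem totalDegree_remainder_two_le :
    (6 * X 0 * X 1 + X 1 ^ 2 + 18 * X 0 + 10 * X 1 + 18 :
      MvPolynomial (Fin 2) K).totalDegree ≤ 2 := by
  repeat' first
    | with_reducible exact totalDegree_X_le _
    | with_reducible exact totalDegree_X_pow_le _ _
    | with_reducible exact totalDegree_ofNat_le 0 _
    | with_reducible exact totalDegree_ofNat_le _ _
    | with_reducible refine totalDegree_sub_le ?_ ?_
    | with_reducible refine totalDegree_add_le ?_ ?_
    | with_reducible apply totalDegree_mul_le_add
    | with_reducible apply totalDegree_mul_le
    | with_reducible exact (totalDegree_X_le _).trans (by norm_num)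
    | with_reducible exact (totalDegree_X_pow_le _ _).trans (by norm_num)
    | (with_reducible show (_ : ℕ) + _ ≤ _; norm_num)

theorem foldG_add_six_fst (n : ℕ) : foldG K (n + 6) 0 =
    X 0 * (foldG K (n + 5) 0 + foldG K (n + 1) 0) -
      (X 0 + X 1 + 3) * (foldG K (n + 4) 0 + foldG K (n + 2) 0) +
      (X 0 ^ 2 - 2 * X 1 - 4) * foldG K (n + 3) 0 - foldG K n 0 := rfl

theorem foldG_add_six_snd (n : ℕ) : foldG K (n + 6) 1 =
    X 1 * (foldG K (n + 5) 1 + foldG K (n + 1) 1) -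
      (X 0 ^ 3 - 3 * X 0 * X 1 - 9 * X 0 - 5 * X 1 - 9) *
        (foldG K (n + 4) 1 + foldG K (n + 2) 1) +
      (X 1 ^ 2 - 2 * X 0 ^ 3 + 6 * X 0 * X 1 + 18 * X 0 + 12 * X 1 + 20) *
        foldG K (n + 3) 1 - foldG K n 1 := rfl

/-- The recursion at `n = -2`, with `G_{-n} = G_n`. -/
theorem foldG_four_snd : foldG K 4 1 = X 1 * (foldG K 3 1 + foldG K 1 1) -
    (X 0 ^ 3 - 3 * X 0 * X 1 - 9 * X 0 - 5 * X 1 - 9) * (foldG K 2 1 + foldG K 0 1) +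
    (X 1 ^ 2 - 2 * X 0 ^ 3 + 6 * X 0 * X 1 + 18 * X 0 + 12 * X 1 + 20) * foldG K 1 1 -
    foldG K 2 1 := by
  simp [foldG, seqG]
  ring

/-- The recursion at `n = -1`, with `G_{-n} = G_n`. -/
theorem foldG_five_snd : foldG K 5 1 = X 1 * (foldG K 4 1 + foldG K 0 1) -
    (X 0 ^ 3 - 3 * X 0 * X 1 - 9 * X 0 - 5 * X 1 - 9) * (foldG K 3 1 + foldG K 1 1) +
    (X 1 ^ 2 - 2 * X 0 ^ 3 + 6 * X 0 * X 1 + 18 * X 0 + 12 * X 1 + 20) * foldG K 2 1 -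
    foldG K 1 1 := by
  simp [foldG, seqG]
  ring

theorem totalDegree_foldG_fst_le : ∀ n, (foldG K n 0).totalDegree ≤ n
  | 0 => totalDegree_ofNat_le 0 6
  | 1 => totalDegree_X_le _
  | 2 => totalDegree_foldG_two_fst_le
  | 3 => totalDegree_foldG_three_fst_le
  | 4 => totalDegree_foldG_four_fst_le
  | 5 => totalDegree_foldG_five_fst_le
  | n + 6 => by
    have h0 := totalDegree_foldG_fst_le n
    have h1 := totalDegree_foldG_fst_le (n + 1)
    have h2 := totalDegree_foldG_fst_le (n + 2)
    have h3 := totalDegree_foldG_fst_le (n + 3)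
    have h4 := totalDegree_foldG_fst_le (n + 4)
    have h5 := totalDegree_foldG_fst_le (n + 5)
    have h15 := totalDegree_add_le h5 (h1.trans (show n + 1 ≤ n + 5 by omega))
    have h24 := totalDegree_add_le h4 (h2.trans (show n + 2 ≤ n + 4 by omega))
    rw [foldG_add_six_fst]
    exact totalDegree_sub_le (totalDegree_add_le (totalDegree_sub_le
      (totalDegree_mul_le (totalDegree_X_le _) h15 (by omega))
      (totalDegree_mul_le totalDegree_coeffTwo_fst_le h24 (by omega)))
      (totalDegree_mul_le totalDegree_coeffThree_fst_le h3 (by omega))) (h0.trans (by omega))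

/-- The slope `3/2` comes from the cubic coefficient that multiplies the value two indices back. For
`n = 4, 5` the recursion continued to negative indices replaces the expanded polynomials. -/
theorem totalDegree_foldG_snd_le : ∀ n, (foldG K n 1).totalDegree ≤ 3 * n / 2
  | 0 => totalDegree_ofNat_le 0 6
  | 1 => totalDegree_X_le _
  | 2 => totalDegree_foldG_two_snd_le
  | 3 => totalDegree_foldG_three_snd_le
  | 4 => by
    have h0 := totalDegree_foldG_snd_le 0
    have h1 := totalDegree_foldG_snd_le 1
    have h2 := totalDegree_foldG_snd_le 2
    have h3 := totalDegree_foldG_snd_le 3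
    have h13 := totalDegree_add_le h3 (h1.trans (by norm_num))
    have h20 := totalDegree_add_le h2 (h0.trans (by norm_num))
    rw [foldG_four_snd]
    exact totalDegree_sub_le (totalDegree_add_le (totalDegree_sub_le
      (totalDegree_mul_le (totalDegree_X_le _) h13 (by norm_num))
      (totalDegree_mul_le totalDegree_coeffTwo_snd_le h20 (by norm_num)))
      (totalDegree_mul_le totalDegree_coeffThree_snd_le h1 (by norm_num)))
      (h2.trans (by norm_num))
  | 5 => by
    have h0 := totalDegree_foldG_snd_le 0
    have h1 := totalDegree_foldG_snd_le 1
    have h2 := totalDegree_foldG_snd_le 2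
    have h3 := totalDegree_foldG_snd_le 3
    have h4 := totalDegree_foldG_snd_le 4
    have h40 := totalDegree_add_le h4 (h0.trans (by norm_num))
    have h31 := totalDegree_add_le h3 (h1.trans (by norm_num))
    rw [foldG_five_snd]
    exact totalDegree_sub_le (totalDegree_add_le (totalDegree_sub_le
      (totalDegree_mul_le (totalDegree_X_le _) h40 (by norm_num))
      (totalDegree_mul_le totalDegree_coeffTwo_snd_le h31 (by norm_num)))
      (totalDegree_mul_le totalDegree_coeffThree_snd_le h2 (by norm_num)))
      (h1.trans (by norm_num))
  | n + 6 => by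
    have h0 := totalDegree_foldG_snd_le n
    have h1 := totalDegree_foldG_snd_le (n + 1)
    have h2 := totalDegree_foldG_snd_le (n + 2)
    have h3 := totalDegree_foldG_snd_le (n + 3)
    have h4 := totalDegree_foldG_snd_le (n + 4)
    have h5 := totalDegree_foldG_snd_le (n + 5)
    have h15 := totalDegree_add_le h5
      (h1.trans (show 3 * (n + 1) / 2 ≤ 3 * (n + 5) / 2 by omega))
    have h24 := totalDegree_add_le h4
      (h2.trans (show 3 * (n + 2) / 2 ≤ 3 * (n + 4) / 2 by omega))
    rw [foldG_add_six_snd]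
    exact totalDegree_sub_le (totalDegree_add_le (totalDegree_sub_le
      (totalDegree_mul_le (totalDegree_X_le _) h15 (by omega))
      (totalDegree_mul_le totalDegree_coeffTwo_snd_le h24 (by omega)))
      (totalDegree_mul_le totalDegree_coeffThree_snd_le h3 (by omega))) (h0.trans (by omega))

/-- The terms of the recursion that contribute to the leading form of `Y_n`. -/
theorem exists_foldG_snd_eq (k : ℕ) : ∃ R : MvPolynomial (Fin 2) K,
    R.totalDegree < 3 * (k + 3) / 2 ∧
      foldG K (k + 3) 1 = X 1 * foldG K (k + 2) 1 - X 0 ^ 3 * foldG K (k + 1) 1 + R := by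
  have hY := totalDegree_foldG_snd_le (K := K)
  have hx : (X 0 ^ 3 : MvPolynomial (Fin 2) K).totalDegree ≤ 3 := totalDegree_X_pow_le 0 3
  -- The recursion proper covers `k ≥ 3`; `k = 1, 2` use its continuation by `G_{-n} = G_n`, and `k
  -- = 0` the explicit `G₃`.
  match k with
  | 0 =>
    refine ⟨_, Nat.lt_succ_of_le totalDegree_remainder_three_le, ?_⟩
    simp [foldG, seqG]
    ring
  | 1 =>
    refine ⟨X 1 * foldG K 1 1 - X 0 ^ 3 * foldG K 0 1 +
      (3 * X 0 * X 1 + 9 * X 0 + 5 * X 1 + 9) * (foldG K 2 1 + foldG K 0 1) +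
      (X 1 ^ 2 - 2 * X 0 ^ 3 + 6 * X 0 * X 1 + 18 * X 0 + 12 * X 1 + 20) * foldG K 1 1 -
      foldG K 2 1, Nat.lt_of_le_of_lt (m := 5) ?_ (by norm_num), ?_⟩
    · exact totalDegree_sub_le (totalDegree_add_le (totalDegree_add_le (totalDegree_sub_le
        (totalDegree_mul_le (totalDegree_X_le _) (hY 1) (by norm_num))
        (totalDegree_mul_le hx (hY 0) (by norm_num)))
        (totalDegree_mul_le totalDegree_coeffTwo_snd_tail_le
          (totalDegree_add_le (hY 2) ((hY 0).trans (by norm_num))) (by norm_num)))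
        (totalDegree_mul_le totalDegree_coeffThree_snd_le (hY 1) (by norm_num)))
        ((hY 2).trans (by norm_num))
    · linear_combination foldG_four_snd (K := K)
  | 2 =>
    refine ⟨X 1 * foldG K 0 1 - X 0 ^ 3 * foldG K 1 1 +
      (3 * X 0 * X 1 + 9 * X 0 + 5 * X 1 + 9) * (foldG K 3 1 + foldG K 1 1) +
      (X 1 ^ 2 - 2 * X 0 ^ 3 + 6 * X 0 * X 1 + 18 * X 0 + 12 * X 1 + 20) * foldG K 2 1 -
      foldG K 1 1, Nat.lt_of_le_of_lt (m := 6) ?_ (by norm_num), ?_⟩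
    · exact totalDegree_sub_le (totalDegree_add_le (totalDegree_add_le (totalDegree_sub_le
        (totalDegree_mul_le (totalDegree_X_le _) (hY 0) (by norm_num))
        (totalDegree_mul_le hx (hY 1) (by norm_num)))
        (totalDegree_mul_le totalDegree_coeffTwo_snd_tail_le
          (totalDegree_add_le (hY 3) ((hY 1).trans (by norm_num))) (by norm_num)))
        (totalDegree_mul_le totalDegree_coeffThree_snd_le (hY 2) (by norm_num)))
        ((hY 1).trans (by norm_num))
    · linear_combination foldG_five_snd (K := K)
  | n + 3 =>
    have h24 := totalDegree_add_le (hY (n + 4))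
      ((hY (n + 2)).trans (show 3 * (n + 2) / 2 ≤ 3 * (n + 4) / 2 by omega))
    refine ⟨X 1 * foldG K (n + 1) 1 - X 0 ^ 3 * foldG K (n + 2) 1 +
      (3 * X 0 * X 1 + 9 * X 0 + 5 * X 1 + 9) * (foldG K (n + 4) 1 + foldG K (n + 2) 1) +
      (X 1 ^ 2 - 2 * X 0 ^ 3 + 6 * X 0 * X 1 + 18 * X 0 + 12 * X 1 + 20) * foldG K (n + 3) 1 -
      foldG K n 1, Nat.lt_of_le_of_lt (m := 3 * (n + 3 + 3) / 2 - 1) ?_ (by omega), ?_⟩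
    · exact totalDegree_sub_le (totalDegree_add_le (totalDegree_add_le (totalDegree_sub_le
        (totalDegree_mul_le (totalDegree_X_le _) (hY (n + 1)) (by omega))
        (totalDegree_mul_le hx (hY (n + 2)) (by omega)))
        (totalDegree_mul_le totalDegree_coeffTwo_snd_tail_le h24 (by omega)))
        (totalDegree_mul_le totalDegree_coeffThree_snd_le (hY (n + 3)) (by omega)))
        ((hY n).trans (by omega))
    · linear_combination foldG_add_six_snd (K := K) n

/-- Parity decides which terms of `Y_{k+3} = yY_{k+2} - x³Y_{k+1} + R` matter. At odd indices both
reach the top degree and the coefficients add, `2 + (2m+1) = 2m+3`; at even indices `yY_{k+2}` drops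
out because of the floor. -/
theorem hasLead_foldG_snd (v : Fin 2 → K) : ∀ m : ℕ,
    HasLead v (3 * m + 1) (foldG K (2 * m + 1) 1) ((2 * m + 1) * (-v 0 ^ 3) ^ m * v 1) ∧
    HasLead v (3 * m + 3) (foldG K (2 * m + 2) 1) (2 * (-v 0 ^ 3) ^ (m + 1))
  | 0 => by
    have h := ((HasLead.X (v := v) 0).pow 3).const_mul (-2)
    have h1 : HasLead v 1 (foldG K 1 1) (v 1) := HasLead.X 1
    refine ⟨by simpa using h1, ?_⟩
    rw [show 2 * (-v 0 ^ 3) ^ (0 + 1) = -2 * v 0 ^ 3 by ring]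
    refine h.add_of_lt (Nat.lt_succ_of_le totalDegree_remainder_two_le) ?_
    simp [foldG, seqG, map_ofNat]
    ring
  | m + 1 => by
    obtain ⟨h1, h2⟩ := hasLead_foldG_snd v m
    have hx := (HasLead.X (v := v) 0).pow 3
    have hy := HasLead.X (v := v) 1
    obtain ⟨R, hR, hRe⟩ := exists_foldG_snd_eq (K := K) (2 * m)
    obtain ⟨S, hS, hSe⟩ := exists_foldG_snd_eq (K := K) (2 * m + 1)
    have h3 : HasLead v (3 * m + 4) (foldG K (2 * m + 3) 1)
        ((2 * m + 3) * (-v 0 ^ 3) ^ (m + 1) * v 1) := by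
      have ha := hy.mul h2
      have hb := hx.mul h1
      rw [show 1 + (3 * m + 3) = 3 * m + 4 by omega] at ha
      rw [show 3 * 1 + (3 * m + 1) = 3 * m + 4 by omega] at hb
      convert (ha.sub hb).add_of_lt (show R.totalDegree < 3 * m + 4 by omega) hRe using 1
      ring
    have h4 : HasLead v (3 * m + 6) (foldG K (2 * m + 4) 1) (2 * (-v 0 ^ 3) ^ (m + 2)) := by
      have ha : HasLead v (3 * m + 6) (X 1 * foldG K (2 * m + 3) 1) 0 :=
        HasLead.of_lt ((totalDegree_mul_le hy.1 h3.1 le_rfl).trans_lt (by omega))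
      have hb := hx.mul h2
      rw [show 3 * 1 + (3 * m + 3) = 3 * m + 6 by omega] at hb
      convert (ha.sub hb).add_of_lt (show S.totalDegree < 3 * m + 6 by omega) hSe using 1
      ring
    refine ⟨?_, h4⟩
    rw [show 3 * (m + 1) + 1 = 3 * m + 4 by ring, show 2 * (m + 1) + 1 = 2 * m + 3 by ring]
    convert h3 using 1
    push_cast
    ring

/-! ### Degree and indeterminacy locus of `G_n` -/

theorem max_totalDegree_foldG [CharZero K] (n : ℕ) :
    max (foldG K n 0).totalDegree (foldG K n 1).totalDegree = 3 * n / 2 := by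
  have hY : (foldG K n 1).totalDegree = 3 * n / 2 := by
    rcases Nat.even_or_odd' n with ⟨m, rfl | rfl⟩
    · cases m with
      | zero => exact totalDegree_ofNat 6
      | succ m =>
        rw [show 2 * (m + 1) = 2 * m + 2 by omega,
          (hasLead_foldG_snd ![1, 0] m).2.totalDegree_eq (by simp)]
        omega
    -- The odd leading form contains the factor `y`, so it is tested at `(1, 1)` instead of `(1,
    -- 0)`; characteristic `0` keeps its coefficient nonzero.
    · have h : (2 * m + 1 : K) ≠ 0 := by exact_mod_cast Nat.succ_ne_zero (2 * m)
      rw [(hasLead_foldG_snd ![1, 1] m).1.totalDegree_eq (by simpa using h)]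
      omega
  have hX := totalDegree_foldG_fst_le (K := K) n
  rw [hY, max_eq_right]
  omega

/-- For `n ≥ 2` the first component has degree at most `n < ⌊3n/2⌋`, so it vanishes identically at
infinity and imposes no condition. -/
theorem mem_indeterminacy_foldG [Infinite K] [CharZero K] {n : ℕ} (hn : 2 ≤ n)
    (p : ℙ K (Fin 3 → K)) : p ∈ (homogenization (foldG K n)).indeterminacy ↔ p.rep 2 = 0 ∧
      eval ![p.rep 0, p.rep 1] (homogeneousComponent (3 * n / 2) (foldG K n 1)) = 0 := by
  rw [mem_indeterminacy_homogenization_of_pos (max_totalDegree_foldG n) (by omega),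
    Fin.forall_fin_two, homogeneousComponent_eq_zero _ (foldG K n 0), map_zero]
  · simp
  · exact (totalDegree_foldG_fst_le n).trans_lt (by omega)

theorem eq_mk_iff_exists {p : ℙ K (Fin 3 → K)} {v : Fin 3 → K} (hv : v ≠ 0) :
    p = Projectivization.mk K v hv ↔ ∃ a : K, a • v = p.rep := by
  conv_lhs => rw [← p.mk_rep]
  exact Projectivization.mk_eq_mk_iff' K _ _ p.rep_nonzero hv

theorem eq_pt010_iff (p : ℙ K (Fin 3 → K)) : p = pt010 K ↔ p.rep 0 = 0 ∧ p.rep 2 = 0 := by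
  rw [pt010, eq_mk_iff_exists]
  constructor
  · rintro ⟨a, ha⟩
    simp [← ha]
  · rintro ⟨h0, h2⟩
    refine ⟨p.rep 1, ?_⟩
    ext i
    fin_cases i <;> simp [h0, h2]

theorem eq_pt100_iff (p : ℙ K (Fin 3 → K)) : p = pt100 K ↔ p.rep 1 = 0 ∧ p.rep 2 = 0 := by
  rw [pt100, eq_mk_iff_exists]
  constructor
  · rintro ⟨a, ha⟩
    simp [← ha]
  · rintro ⟨h1, h2⟩
    refine ⟨p.rep 0, ?_⟩
    ext i
    fin_cases i <;> simp [h1, h2]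

theorem indeterminacy_foldG_of_even [CharZero K] {n : ℕ} (hn : 2 ≤ n)
    (h : Even n) : (homogenization (foldG K n)).indeterminacy = {pt010 K} := by
  obtain ⟨m, rfl⟩ : ∃ m, n = 2 * m + 2 := by
    obtain ⟨m, rfl⟩ := h
    exact ⟨m - 1, by omega⟩
  ext p
  have hl := (hasLead_foldG_snd ![p.rep 0, p.rep 1] m).2.2
  rw [mem_indeterminacy_foldG hn, Set.mem_singleton_iff, eq_pt010_iff,
    show 3 * (2 * m + 2) / 2 = 3 * m + 3 by omega, hl]
  simp [and_comm]

theorem indeterminacy_foldG_of_odd [CharZero K] {n : ℕ} (hn : 2 ≤ n)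
    (h : Odd n) : (homogenization (foldG K n)).indeterminacy = {pt010 K, pt100 K} := by
  obtain ⟨m, rfl⟩ := h
  ext p
  have hl := (hasLead_foldG_snd ![p.rep 0, p.rep 1] m).1.2
  have h : (2 * m + 1 : K) ≠ 0 := by exact_mod_cast Nat.succ_ne_zero (2 * m)
  -- For `m = 0` the form would be just `y`, and `[0,1,0]` would not be a zero.
  have hm : m ≠ 0 := by omega
  rw [mem_indeterminacy_foldG hn, Set.mem_insert_iff, Set.mem_singleton_iff, eq_pt010_iff,
    eq_pt100_iff, show 3 * (2 * m + 1) / 2 = 3 * m + 1 by omega, hl]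
  simp [h, hm]
  tauto

theorem not_isMorphism_foldG [CharZero K] {n : ℕ} (hn : 2 ≤ n) :
    ¬ (homogenization (foldG K n)).IsMorphism := by
  refine Set.Nonempty.ne_empty ⟨pt010 K, ?_⟩
  rcases Nat.even_or_odd n with h | h
  · rw [indeterminacy_foldG_of_even hn h]
    rfl
  · rw [indeterminacy_foldG_of_odd hn h]
    exact Set.mem_insert _ _

/-! ### The dynamical degree of `G_n` -/

theorem degree_foldG [CharZero K] (n : ℕ) : (homogenization (foldG K n)).degree = 3 * n / 2 := by
  rw [degree_homogenization, max_totalDegree_foldG]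

/-- Squeeze: `n^{m+1} ≤ ⌊3n^{m+1}/2⌋ ≤ 2n^{m+1}`, and the root of the constant `2` tends to `1`. The
lower bound needs `n^{m+1}` to be an integer; `n = 0` is included. -/
theorem tendsto_rpow_three_mul_pow_div_two (n : ℕ) :
    Tendsto (fun m : ℕ => ((3 * n ^ (m + 1) / 2 : ℕ) : ℝ) ^ (1 / ((m : ℝ) + 1))) atTop
      (𝓝 (n : ℝ)) := by
  have hinv : Tendsto (fun m : ℕ => 1 / ((m : ℝ) + 1)) atTop (𝓝 0) :=
    tendsto_one_div_add_atTop_nhds_zero_nat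
  have hpow : ∀ m : ℕ, (((n : ℝ) ^ (m + 1)) ^ (1 / ((m : ℝ) + 1))) = n := fun m => by
    have h := Real.pow_rpow_inv_natCast (Nat.cast_nonneg (α := ℝ) n) (Nat.succ_ne_zero m)
    rwa [Nat.cast_succ, ← one_div] at h
  have hupper : Tendsto (fun m : ℕ => (2 : ℝ) ^ (1 / ((m : ℝ) + 1)) * n) atTop (𝓝 (n : ℝ)) := by
    have h := ((tendsto_const_nhds (x := (2 : ℝ))).rpow hinv (Or.inl two_ne_zero)).mul_const (n : ℝ)
    rwa [Real.rpow_zero, one_mul] at h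
  refine tendsto_of_tendsto_of_tendsto_of_le_of_le tendsto_const_nhds hupper
    (fun m => ?_) (fun m => ?_)
  · change (n : ℝ) ≤ _
    rw [← hpow m]
    refine Real.rpow_le_rpow (by positivity) ?_ (by positivity)
    have h : n ^ (m + 1) ≤ 3 * n ^ (m + 1) / 2 := by omega
    exact_mod_cast h
  · change _ ≤ (2 : ℝ) ^ (1 / ((m : ℝ) + 1)) * n
    conv_rhs => rw [← hpow m]
    rw [← Real.mul_rpow (by positivity) (by positivity)]
    refine Real.rpow_le_rpow (by positivity) ?_ (by positivity)
    have h : 3 * n ^ (m + 1) / 2 ≤ 2 * n ^ (m + 1) := by omega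
    exact_mod_cast h

theorem hasDynamicalDegree_foldG [IsAlgClosed K] [CharZero K] (n : ℕ) :
    (homogenization (foldG K n)).HasDynamicalDegree (n : ℝ) := by
  -- The iterate `G_n^{m+1}` is again a folding map, namely `G_{n^{m+1}}`, so its degree is known
  -- exactly.
  refine ⟨fun m => homogenization (foldG K (n ^ (m + 1))), by simp, fun m => ?_, ?_⟩
  · exact isComp_homogenization fun k => by rw [bind₁_foldG, ← pow_succ]
  · simp only [degree_foldG]
    exact tendsto_rpow_three_mul_pow_div_two n

end DegreesG

end Folding

/-! ### The main theorem -/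

theorem theorem5p1 (K : Type*) [Field K] [IsAlgClosed K] [CharZero K] :
    -- `A_n`, `B_n`, `G_n` are the folding maps of the three Lie algebras
    (∀ i : K, i ^ 2 = -1 → ∀ (n : ℕ) (F : Folding.AffMap K),
      Folding.IsFoldingMap (Folding.realCoordA i) n F ↔ F = Folding.foldA K n) ∧
    (∀ (n : ℕ) (F : Folding.AffMap K),
      Folding.IsFoldingMap (Folding.orbitSum Folding.cartanB) n F ↔ F = Folding.foldB K n) ∧
    (∀ (n : ℕ) (F : Folding.AffMap K),
      Folding.IsFoldingMap (Folding.orbitSum Folding.cartanG) n F ↔ F = Folding.foldG K n) ∧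
    -- (a)
    (∀ n : ℕ, (Folding.homogenization (Folding.foldA K n)).IsMorphism ∧
      (Folding.homogenization (Folding.foldA K n)).degree = n) ∧
    -- (b)
    (∀ n : ℕ, (Folding.homogenization (Folding.foldB K n)).IsMorphism ∧
      (Folding.homogenization (Folding.foldB K n)).degree = n) ∧
    -- (c)
    (∀ n : ℕ, (Folding.homogenization (Folding.foldG K n)).degree = ⌊(3 * n / 2 : ℚ)⌋₊) ∧
    (∀ n : ℕ, 2 ≤ n → ¬ (Folding.homogenization (Folding.foldG K n)).IsMorphism ∧
      (Even n → (Folding.homogenization (Folding.foldG K n)).indeterminacy =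
        {Folding.pt010 K}) ∧
      (Odd n → (Folding.homogenization (Folding.foldG K n)).indeterminacy =
        {Folding.pt010 K, Folding.pt100 K})) ∧
    (∀ n : ℕ, (Folding.homogenization (Folding.foldG K n)).HasDynamicalDegree (n : ℝ)) := by
  refine ⟨fun i hi n F => ⟨fun hF => hF.eq (Folding.realCoordA_surjective hi)
      (Folding.isFoldingMap_foldA hi n), ?_⟩,
    fun n F => ⟨fun hF => hF.eq Folding.orbitSum_cartanB_surjective
      (Folding.isFoldingMap_foldB n), ?_⟩,
    fun n F => ⟨fun hF => hF.eq Folding.orbitSum_cartanG_surjective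
      (Folding.isFoldingMap_foldG n), ?_⟩,
    fun n => ⟨Folding.isMorphism_foldA n, ?_⟩, fun n => ⟨Folding.isMorphism_foldB n, ?_⟩,
    fun n => ?_, fun n hn => ⟨Folding.not_isMorphism_foldG hn,
      Folding.indeterminacy_foldG_of_even hn, Folding.indeterminacy_foldG_of_odd hn⟩,
    Folding.hasDynamicalDegree_foldG⟩
  · rintro rfl
    exact Folding.isFoldingMap_foldA hi n
  · rintro rfl
    exact Folding.isFoldingMap_foldB n
  · rintro rfl
    exact Folding.isFoldingMap_foldG n
  · rw [Folding.degree_homogenization, Folding.max_totalDegree_foldA]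
  · rw [Folding.degree_homogenization, Folding.max_totalDegree_foldB]
  · rw [Folding.degree_foldG]
    have h := Nat.floor_div_eq_div (K := ℚ) (3 * n) 2
    push_cast at h
    exact h.symm
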